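/- Call $\sqrt{au_1^2+cu_2^2}$ a best ellipsoid norm, with parameters $a,c>0$, $D\ge 1$, for a norm $\|\cdot\|$ on $\mathbb{R}^2$ if $\sqrt{au_1^2+cu_2^2}\le\|u\|\le D\sqrt{au_1^2+cu_2^2}$ for all $u\in\mathbb{R}^2$ and $(a,c,D)$ maximises $\left(\frac{4ac}{4D^2-1}\right)^{1/4}$ among all triples with this property. For $\theta,\delta\in\mathbb{R}$ let $\Omega(\theta,\delta)=\{(r\cos\beta,r\sin\beta): r\in\mathbb{R},\ \theta-\delta\le\beta\le\theta+\delta\}$. **Theorem 2.** Let $\|\cdot\|$ be a norm on $\mathbb{R}^2$ that has a best ellipsoid norm with parameters $a,c,D$ where $a=1$, and put $M=\left(\frac{4c}{4D^2-1}\right)^{1/4}>0$. Let $0\le\theta<2\pi$ and $\delta>0$. Let $(I_n)_{n\ge0}$ be non-empty open intervals contained in $[0,M]$. Let $m\ge1$ be an integer and let $(z_n)_{n\ge1}$ be a sequence in $\{0,1,\dots,m-1\}$ such that, with $z_0=1$ and $z_{-1}=z_{-2}=0$, for every $n\ge1$ there are integers $s,i$ and a sign $\pm$ with $z_n\equiv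 s z_{n-1}+i z_{n-2}\pm z_{n-3}\pmod m$. Then there is a vector $p_{-1}\in\mathbb{Z}^2\cap\operatorname{int}\Omega(\theta,\delta)$ with coprime coordinates such that, with $q_{-1}=0$, the set of sequences $w_n=(q_n,p_n)\in\mathbb{N}\times\mathbb{Z}^2$ $(n\ge0)$ with all of the following properties has the cardinality of the continuum. Here $v_n=p_n/q_n$, $\psi_{n,j}=q_{j-1}v_n-p_{j-1}$, $R_{n,j}=\|\psi_{n,j}\|$ and $\Pi_{n,j}=\{(\alpha,y)\in\mathbb{R}\times\mathbb{R}^2: 0\le\alpha\le q_j,\ \|\alpha v_n-y\|\le R_{n,j}\}$. 1. (2.1) $\Pi_{n,n}\cap\mathbb{Z}^3=\{w_n,w_{n-1},w_n-w_{n-1},0\}$ for $n\ge1$; $\Pi_{n,j}\cap\mathbb{Z}^3\subseteq\{w_j,w_{j-1},w_j-w_{j-1},0\}$ for $1\le j\le n-1$; and $\operatorname{int}\Pi_{n,j}\cap\mathbb{Z}^3=\varnothing$ for $1\le j\le n$. 2. (2.2) $q_0=1$, and $n q_{n-1}<q_n$ for $n\ge1$. 3. (2.3) $2R_{n,j}<R_{n,j-1}$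 for $1\le j\le n$ (where $R_{n,0}=\|p_{-1}\|$). 4. (2.4) $\sqrt{q_j}\,\|q_{j-1}v_n-p_{j-1}\|\in \operatorname{int} I_{j-1}$ for $1\le j\le n$. 5. (2.5) $\|v_n-v_{n-1}\|<2^{-n}$ for $n\ge1$. 6. (2.6) $\psi_{n,j}\in\operatorname{int}\Omega(\theta,\delta)$ for $1\le j\le n$, and $\psi_{n,j}$, $\psi_{n,j+1}$ lie in opposite open quadrants for $1\le j\le n-1$. 7. (2.7) $q_n\equiv z_n\pmod m$ for $n\ge1$. 8. $\{w_{n-2},w_{n-1},w_n\}$ is a basis of the lattice $\mathbb{Z}^3$ for every $n\ge2$. -/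

import Mathlib

/-! Norms on `ℝ²` are seminorms `N` on `Fin 2 → ℝ` with `N u = 0 → u = 0` (assumed in the theorem).
`ℝ³` is `ℝ × (Fin 2 → ℝ)` and `ℤ³` is `ℤ × (Fin 2 → ℤ)`. -/

noncomputable section

namespace Displacement

/-- The ellipsoid norm `√(a u₁² + c u₂²)`. -/
def ellipsoidNorm (a c : ℝ) (u : Fin 2 → ℝ) : ℝ :=
  Real.sqrt (a * u 0 ^ 2 + c * u 1 ^ 2)

/-- `‖u‖_@ ≤ ‖u‖ ≤ D ‖u‖_@` for all `u`, where `a, c > 0` and `D ≥ 1`. -/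
def IsEllipsoidBound (N : Seminorm ℝ (Fin 2 → ℝ)) (a c D : ℝ) : Prop :=
  0 < a ∧ 0 < c ∧ 1 ≤ D ∧
    ∀ u : Fin 2 → ℝ, ellipsoidNorm a c u ≤ N u ∧ N u ≤ D * ellipsoidNorm a c u

/-- The value `(4ac / (4D² - 1))^{1/4}`. -/
def ellipsoidValue (a c D : ℝ) : ℝ :=
  (4 * a * c / (4 * D ^ 2 - 1)) ^ (1 / 4 : ℝ)

/-- `ellipsoidNorm a c` is a best ellipsoid norm for `N` with parameters `a, c, D`. -/
def IsBestEllipsoidNorm (N : Seminorm ℝ (Fin 2 → ℝ)) (a c D : ℝ) : Prop :=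
  IsEllipsoidBound N a c D ∧
    ∀ a' c' D' : ℝ, IsEllipsoidBound N a' c' D' → ellipsoidValue a' c' D' ≤ ellipsoidValue a c D

/-- The closed double sector `Ω(θ, δ)`. -/
def sector (θ δ : ℝ) : Set (Fin 2 → ℝ) :=
  {x | ∃ r β : ℝ, θ - δ ≤ β ∧ β ≤ θ + δ ∧ x = ![r * Real.cos β, r * Real.sin β]}

/-- `u` and `v` lie in opposite (open) quadrants. -/
def OppositeQuadrants (u v : Fin 2 → ℝ) : Prop :=
  u 0 * v 0 < 0 ∧ u 1 * v 1 < 0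

/-- The real vector with the given integer coordinates. -/
def toReal (p : Fin 2 → ℤ) : Fin 2 → ℝ := fun i => (p i : ℝ)

/-- The inclusion of `ℤ³` into `ℝ³`. -/
def latticePoint (x : ℤ × (Fin 2 → ℤ)) : ℝ × (Fin 2 → ℝ) := ((x.1 : ℝ), toReal x.2)

/-- An element `(q, p)` of `ℕ × ℤ²`, as an element of `ℤ³`. -/
def toZ3 (w : ℕ × (Fin 2 → ℤ)) : ℤ × (Fin 2 → ℤ) := ((w.1 : ℤ), w.2)

/-- The cylinder `Π(u, E, R) = {(α, y) | 0 ≤ α ≤ E, ‖α u - y‖ ≤ R}`. -/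
def cylinder (N : Seminorm ℝ (Fin 2 → ℝ)) (u : Fin 2 → ℝ) (E R : ℝ) : Set (ℝ × (Fin 2 → ℝ)) :=
  {x | 0 ≤ x.1 ∧ x.1 ≤ E ∧ N (x.1 • u - x.2) ≤ R}

/-- The set of integer points lying in `S`, i.e. `S ∩ ℤ³`. -/
def integerPoints (S : Set (ℝ × (Fin 2 → ℝ))) : Set (ℤ × (Fin 2 → ℤ)) := {x | latticePoint x ∈ S}

/-- `vₙ = pₙ / qₙ`. -/
def approx (w : ℕ → ℕ × (Fin 2 → ℤ)) (n : ℕ) : Fin 2 → ℝ :=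
  ((w n).1 : ℝ)⁻¹ • toReal (w n).2

/-- `w_{j-1}`, where `w_{-1} = (0, p)` with `p = p_{-1}`. -/
def prev (p : Fin 2 → ℤ) (w : ℕ → ℕ × (Fin 2 → ℤ)) : ℕ → ℕ × (Fin 2 → ℤ)
  | 0 => (0, p)
  | j + 1 => w j

/-- `ψ_{n,j} = q_{j-1} vₙ - p_{j-1}` (so `ψ_{n,0} = -p_{-1}`). -/
def psi (p : Fin 2 → ℤ) (w : ℕ → ℕ × (Fin 2 → ℤ)) (n j : ℕ) : Fin 2 → ℝ :=
  ((prev p w j).1 : ℝ) • approx w n - toReal (prev p w j).2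

/-- `R_{n,j} = ‖ψ_{n,j}‖`. -/
def radius (N : Seminorm ℝ (Fin 2 → ℝ)) (p : Fin 2 → ℤ) (w : ℕ → ℕ × (Fin 2 → ℤ)) (n j : ℕ) : ℝ :=
  N (psi p w n j)

/-- `Π_{n,j} = Π(vₙ, q_j, R_{n,j})`. -/
def cyl (N : Seminorm ℝ (Fin 2 → ℝ)) (p : Fin 2 → ℤ) (w : ℕ → ℕ × (Fin 2 → ℤ)) (n j : ℕ) :
    Set (ℝ × (Fin 2 → ℝ)) :=
  cylinder N (approx w n) ((w j).1 : ℝ) (radius N p w n j)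

/-- The properties required of the sequence `wₙ = (qₙ, pₙ)`; `p` is the vector `p_{-1}`, which
enters only through `R_{n,0} = ‖p_{-1}‖` in `halving`. -/
structure InductiveProperties (N : Seminorm ℝ (Fin 2 → ℝ)) (θ δ : ℝ) (I : ℕ → Set ℝ)
    (m : ℕ) (z : ℤ → ℤ) (p : Fin 2 → ℤ) (w : ℕ → ℕ × (Fin 2 → ℤ)) : Prop where
  /-- integer points of `Π_{n,n}` -/
  points_eq : ∀ n, 1 ≤ n → integerPoints (cyl N p w n n) =
    {toZ3 (w n), toZ3 (w (n - 1)), toZ3 (w n) - toZ3 (w (n - 1)), 0}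
  /-- integer points of `Π_{n,j}`, `j < n` -/
  points_subset : ∀ n j, 1 ≤ j → j + 1 ≤ n → integerPoints (cyl N p w n j) ⊆
    {toZ3 (w j), toZ3 (w (j - 1)), toZ3 (w j) - toZ3 (w (j - 1)), 0}
  /-- no integer points in the interiors -/
  points_interior : ∀ n j, 1 ≤ n → 1 ≤ j → j ≤ n → integerPoints (interior (cyl N p w n j)) = ∅
  q_zero : (w 0).1 = 1
  q_growth : ∀ n, 1 ≤ n → n * (w (n - 1)).1 < (w n).1
  halving : ∀ n j, 1 ≤ n → 1 ≤ j → j ≤ n → 2 * radius N p w n j < radius N p w n (j - 1)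
  length : ∀ n j, 1 ≤ n → 1 ≤ j → j ≤ n →
    Real.sqrt ((w j).1 : ℝ) * N (((w (j - 1)).1 : ℝ) • approx w n - toReal (w (j - 1)).2)
      ∈ interior (I (j - 1))
  convergence : ∀ n, 1 ≤ n → N (approx w n - approx w (n - 1)) < (1 / 2 : ℝ) ^ n
  direction : ∀ n j, 1 ≤ n → 1 ≤ j → j ≤ n → psi p w n j ∈ interior (sector θ δ)
  opposite : ∀ n j, 1 ≤ j → j + 1 ≤ n → OppositeQuadrants (psi p w n j) (psi p w n (j + 1))
  residue : ∀ n : ℕ, 1 ≤ n → ((w n).1 : ℤ) ≡ z n [ZMOD m]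

/-- Any three consecutive terms of the sequence form a basis of the lattice `ℤ³`. -/
def ConsecutiveBases (w : ℕ → ℕ × (Fin 2 → ℤ)) : Prop :=
  ∀ n, 2 ≤ n → ∃ b : Module.Basis (Fin 3) ℤ (ℤ × (Fin 2 → ℤ)),
    ⇑b = ![toZ3 (w (n - 2)), toZ3 (w (n - 1)), toZ3 (w n)]

/-- Admissible residues: `z_{-2} = z_{-1} = 0`, `z_0 = 1`, and for `n ≥ 1` the residue
`zₙ ∈ {0, …, m-1}` is congruent mod `m` to `s z_{n-1} + i z_{n-2} ± z_{n-3}` for some integers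
`s, i`. Values of `z` at indices below `-2` play no role. -/
def AdmissibleResidues (m : ℕ) (z : ℤ → ℤ) : Prop :=
  z (-2) = 0 ∧ z (-1) = 0 ∧ z 0 = 1 ∧
    ∀ n : ℤ, 1 ≤ n → 0 ≤ z n ∧ z n < m ∧
      ∃ s i : ℤ, z n ≡ s * z (n - 1) + i * z (n - 2) + z (n - 3) [ZMOD m] ∨
        z n ≡ s * z (n - 1) + i * z (n - 2) - z (n - 3) [ZMOD m]

end Displacement

end

open Filter Topology

noncomputable section

namespace Displacement

/-! The sequence is built one point at a time: after `A, B, C` comes `W = ε A + i B + s C` with `ε =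
±1`. The determinant stays `±1`, while `i` and `s` remain free up to prescribed classes modulo `m`,
which handles bases and residues.

Projecting along `W` turns `ℤ³` into a plane lattice of covolume `1 / W.1`, generated by the
displacements of `B` and `C` at `ratio W`. The displacement of `C` is `-(Q / q) e`, where `Q = C.1`,
`q = W.1`, `e = i a + b`, `a = phi B (ratio C)` and `b = ε • phi A (ratio C)`. For large `i` it
points almost along `-a`, so directions stay in the sector while quadrants alternate. Then `s`
places `q` in the window prescribed by the length condition, and makes the other generator project
near a half-integer multiple of `e`. In that near-rhombic position `C` gives the strict minimum off
its own line as long as `3 β⁴ ≤ 4 c`, the hexagonal bound, which follows from `D ≥ 1`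
(`short_vector_lt`, `exists_next_point`). A strict minimum leaves only the four permitted points in
the cylinder (`points_of_strict_minimum`).

All conditions obtained at `ratio W` are open in the direction (`NextGood.eventually`), so they
persist if later ratios stay in a small neighbourhood; nested open sets `U` ensure this. Each stage
has at least two continuations because `W.1` can exceed any bound, and the resulting binary tree
yields continuum many sequences. -/

/-! ### Displacements, determinants and lattice bases -/

/-- The displacement `q v - p` of the integer point `(q, p)` from the line through `(1, v)`. -/
def phi (X : ℤ × (Fin 2 → ℤ)) (v : Fin 2 → ℝ) : Fin 2 → ℝ := (X.1 : ℝ) • v - toReal X.2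

/-- The vector `p / q` of the integer point `(q, p)`. -/
def ratio (X : ℤ × (Fin 2 → ℤ)) : Fin 2 → ℝ := (X.1 : ℝ)⁻¹ • toReal X.2

/-- The determinant of three integer points. -/
def det3 (A B C : ℤ × (Fin 2 → ℤ)) : ℤ :=
  A.1 * (B.2 0 * C.2 1 - B.2 1 * C.2 0) - B.1 * (A.2 0 * C.2 1 - A.2 1 * C.2 0)
    + C.1 * (A.2 0 * B.2 1 - A.2 1 * B.2 0)

lemma phi_apply (X : ℤ × (Fin 2 → ℤ)) (v : Fin 2 → ℝ) (k : Fin 2) :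
    phi X v k = X.1 * v k - X.2 k := by
  simp [phi, toReal]

lemma ratio_apply (X : ℤ × (Fin 2 → ℤ)) (k : Fin 2) : ratio X k = X.2 k / X.1 := by
  simp [ratio, toReal, div_eq_inv_mul]

lemma phi_zero (v : Fin 2 → ℝ) : phi 0 v = 0 := by
  ext k; simp [phi_apply]

lemma phi_add (X Y : ℤ × (Fin 2 → ℤ)) (v : Fin 2 → ℝ) : phi (X + Y) v = phi X v + phi Y v := by
  ext k; simp [phi_apply]; ring

lemma phi_sub (X Y : ℤ × (Fin 2 → ℤ)) (v : Fin 2 → ℝ) : phi (X - Y) v = phi X v - phi Y v := by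
  ext k; simp [phi_apply]; ring

lemma phi_zsmul (n : ℤ) (X : ℤ × (Fin 2 → ℤ)) (v : Fin 2 → ℝ) :
    phi (n • X) v = (n : ℝ) • phi X v := by
  ext k; simp [phi_apply]; ring

lemma phi_ratio_self {X : ℤ × (Fin 2 → ℤ)} (hX : 0 < X.1) : phi X (ratio X) = 0 := by
  have : (X.1 : ℝ) ≠ 0 := by exact_mod_cast hX.ne'
  ext k
  rw [phi_apply, ratio_apply]
  field_simp
  simp

lemma continuous_phi (X : ℤ × (Fin 2 → ℤ)) : Continuous (phi X) := by
  unfold phi; fun_prop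

lemma phi_translate (X : ℤ × (Fin 2 → ℤ)) (v u : Fin 2 → ℝ) :
    phi X (v + u) = phi X v + (X.1 : ℝ) • u := by
  ext k; simp [phi_apply]; ring

lemma ratio_eq_sub {W : ℤ × (Fin 2 → ℤ)} (hW : 0 < W.1) (v : Fin 2 → ℝ) :
    ratio W = v + (-(W.1 : ℝ)⁻¹) • phi W v := by
  have : (W.1 : ℝ) ≠ 0 := by exact_mod_cast hW.ne'
  ext k
  simp only [ratio_apply, Pi.add_apply, Pi.smul_apply, phi_apply, smul_eq_mul]
  field_simp
  ring

/-- Evaluating displacements at `ratio C` is projection along `C`; a unimodular triple thus projects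
to a plane lattice of covolume `1 / C.1`. -/
lemma cross_phi_ratio {A B C : ℤ × (Fin 2 → ℤ)} (hC : 0 < C.1) :
    (phi B (ratio C) 0 * phi A (ratio C) 1 - phi B (ratio C) 1 * phi A (ratio C) 0) * C.1
      = -det3 A B C := by
  have : (C.1 : ℝ) ≠ 0 := by exact_mod_cast hC.ne'
  simp only [phi_apply, ratio_apply, det3]
  push_cast
  field_simp
  ring

lemma det3_step (A B C : ℤ × (Fin 2 → ℤ)) (ε i s : ℤ) :
    det3 B C (ε • A + i • B + s • C) = ε * det3 A B C := by
  simp [det3]; ring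

/-- Cramer's rule: a determinant `±1` is its own inverse, so the coefficients are integers. -/
lemma exists_coordinates {A B C : ℤ × (Fin 2 → ℤ)} (h : det3 A B C ^ 2 = 1)
    (X : ℤ × (Fin 2 → ℤ)) : ∃ x y z : ℤ, X = x • A + y • B + z • C := by
  refine ⟨det3 A B C * det3 X B C, det3 A B C * det3 A X C, det3 A B C * det3 A B X, ?_⟩
  have key : ∀ t : ℤ, t = det3 A B C ^ 2 * t := fun t => by rw [h, one_mul]
  ext k
  · rw [key X.1]; simp [det3]; ring
  · rw [key (X.2 k)]
    fin_cases k <;> simp [det3] <;> ring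

lemma exists_basis {A B C : ℤ × (Fin 2 → ℤ)} (h : det3 A B C ^ 2 = 1) :
    ∃ b : Module.Basis (Fin 3) ℤ (ℤ × (Fin 2 → ℤ)), ⇑b = ![A, B, C] := by
  have hli : LinearIndependent ℤ ![A, B, C] := by
    rw [Fintype.linearIndependent_iff]
    intro g hg
    simp only [Fin.sum_univ_three, Matrix.cons_val_zero, Matrix.cons_val_one,
      Matrix.cons_val] at hg
    have h0 : g 0 * A.1 + g 1 * B.1 + g 2 * C.1 = 0 := by simpa using congrArg Prod.fst hg
    have h1 : g 0 * A.2 0 + g 1 * B.2 0 + g 2 * C.2 0 = 0 := by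
      simpa using congrFun (congrArg Prod.snd hg) 0
    have h2 : g 0 * A.2 1 + g 1 * B.2 1 + g 2 * C.2 1 = 0 := by
      simpa using congrFun (congrArg Prod.snd hg) 1
    have hd : det3 A B C ≠ 0 := by rintro hd; simp [hd] at h
    have e0 : det3 A B C * g 0 = 0 := by
      simp only [det3]
      linear_combination (B.2 0 * C.2 1 - B.2 1 * C.2 0) * h0
        - (B.1 * C.2 1 - B.2 1 * C.1) * h1 + (B.1 * C.2 0 - B.2 0 * C.1) * h2
    have e1 : det3 A B C * g 1 = 0 := by
      simp only [det3]
      linear_combination -(A.2 0 * C.2 1 - A.2 1 * C.2 0) * h0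
        + (A.1 * C.2 1 - A.2 1 * C.1) * h1 - (A.1 * C.2 0 - A.2 0 * C.1) * h2
    have e2 : det3 A B C * g 2 = 0 := by
      simp only [det3]
      linear_combination (A.2 0 * B.2 1 - A.2 1 * B.2 0) * h0
        - (A.1 * B.2 1 - A.2 1 * B.1) * h1 + (A.1 * B.2 0 - A.2 0 * B.1) * h2
    intro k
    fin_cases k
    · exact (mul_eq_zero.mp e0).resolve_left hd
    · exact (mul_eq_zero.mp e1).resolve_left hd
    · exact (mul_eq_zero.mp e2).resolve_left hd
  refine ⟨Module.Basis.mk hli ?_, Module.Basis.coe_mk _ _⟩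
  intro X _
  obtain ⟨x, y, z, rfl⟩ := exists_coordinates h X
  have hm : ∀ k, ![A, B, C] k ∈ Submodule.span ℤ (Set.range ![A, B, C]) :=
    fun k => Submodule.subset_span ⟨k, rfl⟩
  exact add_mem (add_mem (Submodule.smul_mem _ _ (hm 0)) (Submodule.smul_mem _ _ (hm 1)))
    (Submodule.smul_mem _ _ (hm 2))

/-! ### Shortest vectors in the projected plane lattice -/

/-- An integer multiple of a number close to a half-integer stays away from the integers, if the
multiplier is `±1`. -/
lemma sq_le_sq_sub_int {τ η : ℝ} {T k l : ℤ} (hη : η ≤ 1 / 2) (hτ : |τ - T - 1 / 2| ≤ η)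
    (hk : k = 1 ∨ k = -1) : (1 / 2 - η) ^ 2 ≤ (k * τ - l) ^ 2 := by
  rw [abs_le] at hτ
  rw [sq_le_sq, abs_of_nonneg (by linarith), le_abs]
  rcases hk with rfl | rfl
  · rcases le_or_gt l T with h | h
    · left
      have : (l : ℝ) ≤ T := by exact_mod_cast h
      push_cast; linarith [hτ.1]
    · right
      have : (T : ℝ) + 1 ≤ l := by exact_mod_cast h
      push_cast; linarith [hτ.2]
  · rcases le_or_gt (-l) T with h | h
    · right
      have : -(l : ℝ) ≤ T := by exact_mod_cast h
      push_cast; linarith [hτ.1]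
    · left
      have : (T : ℝ) + 1 ≤ -l := by exact_mod_cast h
      push_cast; linarith [hτ.2]

/-- Splits the ellipsoid norm of a lattice vector into its component along `e` and a transverse part
that depends only on `k` and the covolume. -/
lemma lagrange_identity (c k t : ℝ) (a e : Fin 2 → ℝ) :
    (e 0 ^ 2 + c * e 1 ^ 2) * ((k • a - t • e) 0 ^ 2 + c * (k • a - t • e) 1 ^ 2)
      = (k * (a 0 * e 0 + c * (a 1 * e 1)) - t * (e 0 ^ 2 + c * e 1 ^ 2)) ^ 2
        + c * k ^ 2 * (a 0 * e 1 - a 1 * e 0) ^ 2 := by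
  simp; ring

/-- The case `k = ±1`, where both components are needed. Here `E` and `P` are the squared ellipsoid
norm and squared norm of `e`; the gap between them is absorbed by `(P - E) (P - κ (P + E)) ≥ 0`. -/
lemma mul_lt_add_of_near {E P κ Y C z : ℝ} (hE : 0 < E) (hEP : E ≤ P)
    (hκ : κ ≤ 1 / 4) (hY : 0 ≤ Y) (h : (1 - κ) * (Y * P ^ 2) < C) (hz : κ ≤ z) :
    E * (Y * P) < E ^ 2 * Y * z + C := by
  have h2 : E ^ 2 * Y * κ ≤ E ^ 2 * Y * z := mul_le_mul_of_nonneg_left hz (by positivity)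
  have h3 : E * P - E ^ 2 * κ ≤ (1 - κ) * P ^ 2 := by
    have h0 : κ * (P + E) ≤ 1 / 4 * (P + E) := mul_le_mul_of_nonneg_right hκ (by linarith)
    have : 0 ≤ (P - E) * (P - κ * (P + E)) := mul_nonneg (by linarith) (by linarith)
    linarith
  have h4 := mul_le_mul_of_nonneg_left h3 hY
  linarith

/-- The case `|k| ≥ 2`: the transverse part, at least four times the one for `k = ±1`, suffices
alone. -/
lemma mul_lt_add_of_far {E P κ Y C S r : ℝ} (hE : 0 < E) (hEP : E ≤ P) (hC : 0 < C)
    (hκ : κ ≤ 1 / 4) (hY : 0 ≤ Y) (h : (1 - κ) * (Y * P ^ 2) < C) (hS : 0 ≤ S) (hr : 4 ≤ r) :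
    E * (Y * P) < S + C * r := by
  have h1 : Y * (E * P) ≤ Y * P ^ 2 := by
    rw [sq]; exact mul_le_mul_of_nonneg_left (mul_le_mul_of_nonneg_right hEP (by linarith)) hY
  have h2 : 0 ≤ Y * P ^ 2 := by positivity
  have h3 := mul_le_mul_of_nonneg_right hκ h2
  have h4 := mul_le_mul_of_nonneg_left hr hC.le
  linarith

/-- In the plane lattice generated by `(Q / q) e` and `a - (t / q) e`, if the generator
`(Q / q) e` is short compared with the covolume and the other one projects close to a half-integer
multiple of it, then every vector outside the line of `e` is longer than `(Q / q) e`. -/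
lemma short_vector_lt {N : Seminorm ℝ (Fin 2 → ℝ)} {c : ℝ} (hc : 0 < c)
    (hN : ∀ u, u 0 ^ 2 + c * u 1 ^ 2 ≤ N u ^ 2) {a e : Fin 2 → ℝ} {q Q t η : ℝ}
    (hq : 0 < q) (hQ : 0 < Q) (hη0 : 0 ≤ η) (hη : η ≤ 1 / 2)
    (hE : 0 < e 0 ^ 2 + c * e 1 ^ 2) (hcross : ((a 0 * e 1 - a 1 * e 0) * Q) ^ 2 = 1)
    (hshort : (1 - (1 / 2 - η) ^ 2) * (Q ^ 2 * N e ^ 2 / q) ^ 2 < c) {T : ℤ}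
    (hT : |q / Q * (a 0 * e 0 + c * (a 1 * e 1)) / (e 0 ^ 2 + c * e 1 ^ 2) - t / Q - T - 1 / 2| ≤ η)
    {k l : ℤ} (hk : k ≠ 0) :
    N ((Q / q) • e) < N ((k : ℝ) • a - ((k * t + l * Q) / q) • e) := by
  set E := e 0 ^ 2 + c * e 1 ^ 2 with hEdef
  set H := a 0 * e 0 + c * (a 1 * e 1) with hH
  set x := (k : ℝ) • a - ((k * t + l * Q) / q) • e with hx
  set P := N e ^ 2 with hP
  have hEP : E ≤ P := hN e
  have hx2 := hN x
  have hlag := lagrange_identity c k ((k * t + l * Q) / q) a e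
  rw [← hx, ← hEdef, ← hH] at hlag
  have hcr : (a 0 * e 1 - a 1 * e 0) ^ 2 = 1 / Q ^ 2 := by
    rw [mul_pow] at hcross
    field_simp
    exact hcross
  rw [hcr] at hlag
  have hκ : (1 / 2 - η) ^ 2 ≤ 1 / 4 := by nlinarith
  have hκ0 : 0 ≤ (1 / 2 - η) ^ 2 := sq_nonneg _
  set κ := (1 / 2 - η) ^ 2 with hκd
  have hshort' : (1 - κ) * ((Q / q) ^ 2 * P ^ 2) < c * (1 / Q ^ 2) := by
    have : (1 - κ) * ((Q / q) ^ 2 * P ^ 2) = (1 - κ) * (Q ^ 2 * P / q) ^ 2 * (1 / Q ^ 2) := by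
      field_simp
    rw [this]
    exact mul_lt_mul_of_pos_right hshort (by positivity)
  have hy : 0 < (Q / q) ^ 2 := by positivity
  have hmain : E * ((Q / q) ^ 2 * P) < E * N x ^ 2 := by
    refine lt_of_lt_of_le ?_ (mul_le_mul_of_nonneg_left hx2 hE.le)
    rw [hlag]
    by_cases h1 : k = 1 ∨ k = -1
    · have hk2 : (k : ℝ) ^ 2 = 1 := by rcases h1 with rfl | rfl <;> norm_num
      have hsep := sq_le_sq_sub_int (l := l) hη hT h1
      have hform : k * H - (k * t + l * Q) / q * E
          = E * (Q / q) * (k * (q / Q * H / E - t / Q) - l) := by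
        field_simp
        ring
      rw [hform, hk2, mul_pow, mul_pow]
      rw [mul_one]
      exact mul_lt_add_of_near hE hEP hκ hy.le hshort' hsep
    · have hk4 : (4 : ℝ) ≤ (k : ℝ) ^ 2 := by
        push Not at h1
        have : (2 : ℤ) ≤ |k| := by
          rcases abs_cases k with ⟨h, _⟩ | ⟨h, _⟩ <;> omega
        have h2 : (4 : ℤ) ≤ k ^ 2 := by
          rw [← sq_abs]; nlinarith
        exact_mod_cast h2
      rw [mul_right_comm]
      exact mul_lt_add_of_far hE hEP (by positivity) hκ hy.le hshort' (sq_nonneg _) hk4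
  have hsq : N ((Q / q) • e) ^ 2 < N x ^ 2 := by
    rw [map_smul_eq_mul, mul_pow, Real.norm_eq_abs, sq_abs]
    exact lt_of_mul_lt_mul_left hmain hE.le
  exact lt_of_pow_lt_pow_left₀ 2 (apply_nonneg N x) hsq

/-! ### Choice of the next lattice point -/

/-- A point of an arithmetic progression just above a half-integer multiple of `S`. -/
lemma exists_progression_near_half (lo S μ g t : ℝ) (hS : 0 < S) (hμ : 0 < μ) :
    ∃ T j : ℤ, lo ≤ g + μ * j ∧ g + μ * j < lo + S + μ ∧
      |(g + μ * j) / S - t - T - 1 / 2| ≤ μ / S := by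
  -- `y` is the first shifted half-integer multiple of `S` at or above `lo`; `j` then gives the
  -- first term of the progression at or above `y`.
  set T : ℤ := ⌈lo / S - t - 1 / 2⌉ with hT
  set y : ℝ := S * (T + 1 / 2 + t) with hy
  set j : ℤ := ⌈(y - g) / μ⌉ with hj
  have hT1 := Int.le_ceil (lo / S - t - 1 / 2)
  have hT2 := Int.ceil_lt_add_one (lo / S - t - 1 / 2)
  have hj1 := Int.le_ceil ((y - g) / μ)
  have hj2 := Int.ceil_lt_add_one ((y - g) / μ)
  rw [← hT] at hT1 hT2
  rw [← hj] at hj1 hj2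
  have hlo : lo ≤ y := by
    have := mul_le_mul_of_nonneg_left hT1 hS.le
    have h : S * (lo / S) = lo := by field_simp
    nlinarith
  have hhi : y < lo + S := by
    have := mul_lt_mul_of_pos_left hT2 hS
    have h : S * (lo / S) = lo := by field_simp
    nlinarith
  have h1 : y ≤ g + μ * j := by
    rw [div_le_iff₀ hμ] at hj1; linarith
  have h2 : g + μ * j < y + μ := by
    have h := mul_lt_mul_of_pos_left hj2 hμ
    have h' : μ * ((y - g) / μ) = y - g := by field_simp
    nlinarith
  refine ⟨T, j, by linarith, by linarith, ?_⟩
  have h3 : (g + μ * j) / S - t - T - 1 / 2 = (g + μ * j - y) / S := by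
    rw [hy]; field_simp; ring
  rw [h3, abs_of_nonneg (div_nonneg (by linarith) hS.le)]
  gcongr
  linarith

lemma exists_bound_mem_of_mem_nhds {N : Seminorm ℝ (Fin 2 → ℝ)} {c : ℝ} (hc : 0 < c)
    (hN : ∀ u, u 0 ^ 2 + c * u 1 ^ 2 ≤ N u ^ 2) {v : Fin 2 → ℝ} {O : Set (Fin 2 → ℝ)}
    (hO : O ∈ 𝓝 v) : ∃ ρ : ℝ, 0 < ρ ∧ ∀ u, N u ^ 2 < ρ → v + u ∈ O := by
  obtain ⟨d, hd, hball⟩ := Metric.mem_nhds_iff.mp hO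
  refine ⟨min (d ^ 2) (c * d ^ 2), by positivity, fun u hu => hball ?_⟩
  have h := (hN u).trans_lt hu
  have h0 : u 0 ^ 2 < d ^ 2 := by
    have := h.trans_le (min_le_left _ _)
    have : 0 ≤ c * u 1 ^ 2 := by positivity
    linarith
  have h1 : u 1 ^ 2 < d ^ 2 := by
    have := h.trans_le (min_le_right _ _)
    have : 0 ≤ u 0 ^ 2 := by positivity
    exact lt_of_mul_lt_mul_left (by linarith) hc.le
  rw [mem_ball_iff_norm, add_sub_cancel_left, pi_norm_lt_iff hd]
  intro k
  fin_cases k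
  · exact abs_lt_of_sq_lt_sq h0 hd.le
  · exact abs_lt_of_sq_lt_sq h1 hd.le

/-- The factor `3 / 4` is the value at `η = 0`, an exact half-integer projection; strictness leaves
room for a positive error `η`. -/
lemma exists_pos_deficit {c x : ℝ} (h : 3 / 4 * x < c) :
    ∃ η : ℝ, 0 < η ∧ η ≤ 1 / 2 ∧ (1 - (1 / 2 - η) ^ 2) * x < c := by
  have hcont : Tendsto (fun η : ℝ => (1 - (1 / 2 - η) ^ 2) * x) (𝓝[>] 0)
      (𝓝 ((1 - (1 / 2 - 0) ^ 2) * x)) :=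
    ((by fun_prop : Continuous fun η : ℝ => (1 - (1 / 2 - η) ^ 2) * x).tendsto 0).mono_left
      nhdsWithin_le_nhds
  have h1 := hcont.eventually_lt_const (u := c) (by norm_num; linarith)
  have h2 : ∀ᶠ η : ℝ in 𝓝[>] 0, η ∈ Set.Ioc (0 : ℝ) (1 / 2) :=
    Ioc_mem_nhdsGT (by norm_num)
  obtain ⟨η, h3, h4⟩ := (h1.and h2).exists
  exact ⟨η, h4.1, h4.2, h3⟩

lemma cauchy_schwarz_ellipsoid {c : ℝ} (hc : 0 < c) (a e : Fin 2 → ℝ) :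
    (a 0 * e 0 + c * (a 1 * e 1)) ^ 2
      ≤ (a 0 ^ 2 + c * a 1 ^ 2) * (e 0 ^ 2 + c * e 1 ^ 2) := by
  have : 0 ≤ c * (a 0 * e 1 - a 1 * e 0) ^ 2 := by positivity
  linarith

/-- The inner product grows linearly along the line, and Cauchy–Schwarz passes this growth to the
norm. Both limits serve to choose `i`. -/
lemma tendsto_norm_sq_line {N : Seminorm ℝ (Fin 2 → ℝ)} {c : ℝ} (hc : 0 < c)
    (hN : ∀ u, u 0 ^ 2 + c * u 1 ^ 2 ≤ N u ^ 2) {a : Fin 2 → ℝ} (ha : a 0 ≠ 0) (b : Fin 2 → ℝ) :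
    Tendsto (fun x : ℝ => a 0 * (x • a + b) 0 + c * (a 1 * (x • a + b) 1)) atTop atTop ∧
    Tendsto (fun x : ℝ => N (x • a + b) ^ 2) atTop atTop := by
  have haa : 0 < a 0 ^ 2 + c * a 1 ^ 2 := by positivity
  have hH : Tendsto (fun x : ℝ => a 0 * (x • a + b) 0 + c * (a 1 * (x • a + b) 1))
      atTop atTop := by
    have : (fun x : ℝ => a 0 * (x • a + b) 0 + c * (a 1 * (x • a + b) 1))
        = fun x => x * (a 0 ^ 2 + c * a 1 ^ 2) + (a 0 * b 0 + c * (a 1 * b 1)) := by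
      ext x; simp; ring
    rw [this]
    exact tendsto_atTop_add_const_right _ _ (tendsto_id.atTop_mul_const haa)
  refine ⟨hH, tendsto_atTop_mono (fun x => ?_)
    (((tendsto_pow_atTop two_ne_zero).comp hH).atTop_div_const haa)⟩
  refine le_trans ?_ (hN _)
  rw [div_le_iff₀' haa]
  exact cauchy_schwarz_ellipsoid hc _ _

/-- The squared normalised length is `Q² P / q` with `P = N e ^ 2`, so the length condition asks `q`
to lie in an interval of size proportional to `P`. The steps needed to adjust the half-integer
position and the residue of `s` are of sizes `Q E / H` and `m Q`, which are small compared with `P`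
once `i` is large. -/
lemma exists_next_point {N : Seminorm ℝ (Fin 2 → ℝ)} {c : ℝ} (hc : 0 < c)
    (hN : ∀ u, u 0 ^ 2 + c * u 1 ^ 2 ≤ N u ^ 2) {A B C : ℤ × (Fin 2 → ℤ)}
    (hdet : det3 A B C ^ 2 = 1) (hC : 0 < C.1) (ha : phi B (ratio C) 0 ≠ 0)
    {ε : ℤ} (hε : ε ^ 2 = 1) (i₀ s₀ : ℤ) {m : ℕ} (hm : 1 ≤ m) {α β : ℝ} (hα : 0 ≤ α)
    (hαβ : α < β) (hβ : 3 * β ^ 4 ≤ 4 * c) {O V : Set (Fin 2 → ℝ)} (hO : O ∈ 𝓝 (ratio C))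
    (hV : V ∈ 𝓝 (phi B (ratio C))) (K : ℝ) :
    ∃ i s : ℤ, ∃ W : ℤ × (Fin 2 → ℤ), W = ε • A + i • B + s • C ∧ i ≡ i₀ [ZMOD m] ∧
      s ≡ s₀ [ZMOD m] ∧ K < W.1 ∧ 0 < W.1 ∧ ratio W ∈ O ∧
      (∃ r : ℝ, 0 < r ∧ ∃ e ∈ V, phi C (ratio W) = -(r • e)) ∧
      Real.sqrt W.1 * N (phi C (ratio W)) ∈ Set.Ioo α β ∧
      ∀ k l : ℤ, k ≠ 0 →
        N (phi C (ratio W)) < N ((k : ℝ) • phi B (ratio W) + (l : ℝ) • phi C (ratio W)) := by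
  set a := phi B (ratio C) with hadef
  set b := (ε : ℝ) • phi A (ratio C) with hb
  set Q : ℝ := (C.1 : ℝ) with hQdef
  have hQ : 0 < Q := Int.cast_pos.mpr hC
  have hm0 : (0 : ℝ) < m := by exact_mod_cast hm
  -- `β' < β` makes the hexagonal bound strict; `α' > α` is positive even when `α = 0`, so it can be
  -- divided by.
  obtain ⟨β', hαβ', hβ'⟩ := exists_between hαβ
  obtain ⟨α', hα', hαβ''⟩ := exists_between hαβ'
  have hα'0 : 0 < α' := hα.trans_lt hα'
  have hβ'0 : 0 < β' := hα'0.trans hαβ''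
  obtain ⟨η, hη0, hη, hκ⟩ : ∃ η : ℝ, 0 < η ∧ η ≤ 1 / 2 ∧
      (1 - (1 / 2 - η) ^ 2) * (β' ^ 2) ^ 2 < c := by
    apply exists_pos_deficit
    have : β' ^ 4 < β ^ 4 := by gcongr
    nlinarith
  obtain ⟨ρ, hρ, hρO⟩ := exists_bound_mem_of_mem_nhds hc hN hO
  have haa : 0 < a 0 ^ 2 + c * a 1 ^ 2 := by positivity
  -- `L * P` is the length of the window from `Q² P / β'²` to `Q² P / α'²` for `q`.
  set L : ℝ := Q ^ 2 * (1 / α' ^ 2 - 1 / β' ^ 2) with hL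
  have hL0 : 0 < L := by
    have : 1 / β' ^ 2 < 1 / α' ^ 2 := by gcongr
    have : 0 < 1 / α' ^ 2 - 1 / β' ^ 2 := by linarith
    positivity
  -- the choice of `i`
  have hi : Tendsto (fun k : ℕ => ((i₀ + m * k : ℤ) : ℝ)) atTop atTop := by
    push_cast
    exact tendsto_atTop_add_const_left _ _ (tendsto_natCast_atTop_atTop.const_mul_atTop hm0)
  obtain ⟨hHt, hPt⟩ := tendsto_norm_sq_line hc hN ha b
  have hVt : ∀ᶠ x : ℝ in atTop, a + x⁻¹ • b ∈ V := by
    have : Tendsto (fun x : ℝ => a + x⁻¹ • b) atTop (𝓝 (a + (0 : ℝ) • b)) :=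
      tendsto_const_nhds.add (tendsto_inv_atTop_zero.smul_const b)
    rw [zero_smul, add_zero] at this
    exact this.eventually hV
  -- The bounds with `L` make each of the two steps at most half the window; the one with `η`
  -- controls the half-integer error; the last two give `q > K` and `ratio W ∈ O`.
  have hev := (eventually_gt_atTop (0 : ℝ)).and <| hVt.and <|
    (hHt.eventually_ge_atTop (2 * Q / L)).and <|
    (hHt.eventually_ge_atTop (m * (a 0 ^ 2 + c * a 1 ^ 2) / η)).and <|
    (hPt.eventually_ge_atTop (2 * (m * Q) / L)).and <|
    (hPt.eventually_gt_atTop (K * β' ^ 2 / Q ^ 2)).and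
    (hPt.eventually_gt_atTop (β' ^ 4 / (Q ^ 4 * ρ)))
  obtain ⟨k₀, hi0, heV, hH1, hH2, hP1, hP2, hP3⟩ := (hi.eventually hev).exists
  set i : ℤ := i₀ + m * k₀ with hidef
  set e : Fin 2 → ℝ := (i : ℝ) • a + b with he
  set H : ℝ := a 0 * e 0 + c * (a 1 * e 1) with hH
  set E : ℝ := e 0 ^ 2 + c * e 1 ^ 2 with hE
  have hEP : E ≤ N e ^ 2 := hN e
  have hcs : H ^ 2 ≤ (a 0 ^ 2 + c * a 1 ^ 2) * E := cauchy_schwarz_ellipsoid hc a e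
  set P : ℝ := N e ^ 2 with hP
  have hH0 : 0 < H := lt_of_lt_of_le (by positivity) hH1
  have hE0 : 0 < E := by
    have : 0 < (a 0 ^ 2 + c * a 1 ^ 2) * E := lt_of_lt_of_le (by positivity) hcs
    exact pos_of_mul_pos_right this haa.le
  have hP0 : 0 < P := hE0.trans_le hEP
  -- the choice of `s`
  obtain ⟨T, j, hj1, hj2, hj3⟩ := exists_progression_near_half (Q ^ 2 * P / β' ^ 2) (Q * E / H)
    (m * Q) (ε * A.1 + i * B.1 + s₀ * Q) (B.1 / Q) (by positivity) (by positivity)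
  set s : ℤ := s₀ + m * j with hs
  set W := ε • A + i • B + s • C with hW
  set q : ℝ := (W.1 : ℝ) with hq
  have hqval : (ε * A.1 + i * B.1 + s₀ * Q) + m * Q * j = q := by
    rw [hq, hW, hs, hQdef]; simp; ring
  rw [hqval] at hj1 hj2 hj3
  have hq0 : 0 < q := lt_of_lt_of_le (by positivity) hj1
  have hWpos : 0 < W.1 := Int.cast_pos.mp hq0
  have hphiW : phi W (ratio C) = e := by
    rw [hW, phi_add, phi_add, phi_zsmul, phi_zsmul, phi_zsmul, phi_ratio_self hC, he, hb,
      smul_zero, add_zero, add_comm]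
  have hratio : ratio W = ratio C + (-q⁻¹) • e := by
    rw [ratio_eq_sub hWpos (ratio C), hphiW]
  have hphiC : phi C (ratio W) = -((Q / q) • e) := by
    rw [hratio, phi_translate, phi_ratio_self hC, zero_add, smul_smul, ← neg_smul]
    congr 1; ring
  have hphiB : phi B (ratio W) = a - (B.1 / q : ℝ) • e := by
    rw [hratio, phi_translate, smul_smul, sub_eq_add_neg, ← neg_smul]
    congr 2; ring
  have hQP1 : Q ^ 2 * P / q ≤ β' ^ 2 := by
    rw [div_le_iff₀ (by positivity)] at hj1
    rw [div_le_iff₀ hq0]; linarith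
  have hhi : q < Q ^ 2 * P / α' ^ 2 := by
    refine hj2.trans_le ?_
    have h1 : Q * E / H ≤ L / 2 * P := by
      rw [div_le_iff₀ hL0] at hH1
      rw [div_le_iff₀ hH0]
      calc Q * E ≤ Q * P := by gcongr
        _ = P * (2 * Q) / 2 := by ring
        _ ≤ P * (H * L) / 2 := by gcongr
        _ = L / 2 * P * H := by ring
    have h2 : m * Q ≤ L / 2 * P := by
      rw [div_le_iff₀ hL0] at hP1; linarith
    have h3 : Q ^ 2 * P / α' ^ 2 = Q ^ 2 * P / β' ^ 2 + L * P := by rw [hL]; ring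
    linarith
  have hQP2 : α' ^ 2 < Q ^ 2 * P / q := by
    rw [lt_div_iff₀ (by positivity)] at hhi
    rw [lt_div_iff₀ hq0]; linarith
  have hNC : N (phi C (ratio W)) = Q / q * N e := by
    rw [hphiC, map_neg_eq_map, map_smul_eq_mul, Real.norm_of_nonneg (by positivity)]
  refine ⟨i, s, W, rfl, ?_, ?_, ?_, hWpos, ?_, ⟨Q * i / q, by positivity, _, heV, ?_⟩, ?_, ?_⟩
  · rw [hidef]; exact Int.modEq_iff_dvd.mpr ⟨-k₀, by ring⟩
  · rw [hs]; exact Int.modEq_iff_dvd.mpr ⟨-j, by ring⟩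
  · refine lt_of_lt_of_le ?_ hj1
    rw [div_lt_iff₀ (by positivity)] at hP2
    rw [lt_div_iff₀ (by positivity)]; linarith
  · rw [hratio]
    apply hρO
    rw [map_smul_eq_mul, mul_pow, Real.norm_eq_abs, sq_abs, neg_sq, inv_pow, ← hP, inv_mul_eq_div,
      div_lt_iff₀ (by positivity)]
    rw [div_lt_iff₀ (by positivity)] at hP3
    have h1 : (Q ^ 2 * P / β' ^ 2) ^ 2 ≤ q ^ 2 := by gcongr
    have h2 : P * β' ^ 4 < ρ * (Q ^ 2 * P) ^ 2 := by
      have := mul_lt_mul_of_pos_left hP3 hP0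
      linarith
    have h3 : P < ρ * (Q ^ 2 * P / β' ^ 2) ^ 2 := by
      rw [div_pow, ← mul_div_assoc, lt_div_iff₀ (by positivity), ← pow_mul]
      exact h2
    exact h3.trans_le (by gcongr)
  · rw [hphiC, he]
    ext k
    simp only [Pi.neg_apply, Pi.smul_apply, Pi.add_apply, smul_eq_mul]
    field_simp
  · have hsq : (Real.sqrt q * (Q / q * N e)) ^ 2 = Q ^ 2 * P / q := by
      rw [mul_pow, Real.sq_sqrt hq0.le]
      field_simp
      rfl
    rw [hNC, Set.mem_Ioo]
    have h0 : 0 ≤ Real.sqrt q * (Q / q * N e) := by positivity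
    constructor
    · refine hα'.trans (lt_of_pow_lt_pow_left₀ 2 h0 ?_)
      rwa [hsq]
    · refine lt_of_le_of_lt ?_ hβ'
      rw [← pow_le_pow_iff_left₀ h0 hβ'0.le two_ne_zero, hsq]
      exact hQP1
  · intro k l hk
    have hcross : ((a 0 * e 1 - a 1 * e 0) * Q) ^ 2 = 1 := by
      have h1 : (a 0 * e 1 - a 1 * e 0) * Q = ε * -det3 A B C := by
        rw [← cross_phi_ratio hC, he, hb]
        simp
        ring
      rw [h1, mul_pow, neg_sq]
      exact_mod_cast (by rw [hε, hdet]; norm_num : ε ^ 2 * det3 A B C ^ 2 = 1)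
    have hT : |q / Q * H / E - B.1 / Q - T - 1 / 2| ≤ η := by
      have h1 : q / (Q * E / H) = q / Q * H / E := by field_simp
      rw [← h1]
      refine hj3.trans ?_
      -- By Cauchy–Schwarz `m H / E` is at most `m (a₀² + c a₁²) / H`, which the choice of `i` makes
      -- at most `η`.
      have h2 : m * Q / (Q * E / H) = m * H / E := by field_simp
      rw [h2, div_le_iff₀ hE0]
      rw [div_le_iff₀ hη0] at hH2
      refine le_of_mul_le_mul_right ?_ hH0
      calc m * H * H = m * H ^ 2 := by ring
        _ ≤ m * ((a 0 ^ 2 + c * a 1 ^ 2) * E) := by gcongr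
        _ = m * (a 0 ^ 2 + c * a 1 ^ 2) * E := by ring
        _ ≤ H * η * E := by gcongr
        _ = η * E * H := by ring
    have hκ0 : 0 ≤ 1 - (1 / 2 - η) ^ 2 := by
      have : (1 / 2 - η) ^ 2 ≤ 1 ^ 2 := by gcongr; linarith
      linarith
    have hshort : (1 - (1 / 2 - η) ^ 2) * (Q ^ 2 * P / q) ^ 2 < c := by
      refine lt_of_le_of_lt ?_ hκ
      gcongr
    have hmain := short_vector_lt (a := a) (e := e) (t := (B.1 : ℝ)) hc hN hq0 hQ hη0.le hη hE0 hcross hshort hT (l := l) hk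
    have h1 : (k : ℝ) • phi B (ratio W) + (l : ℝ) • phi C (ratio W)
        = (k : ℝ) • a - ((k * B.1 + l * Q) / q) • e := by
      rw [hphiB, hphiC]
      ext n
      simp only [Pi.add_apply, Pi.sub_apply, Pi.neg_apply, Pi.smul_apply, smul_eq_mul]
      ring
    rwa [h1, hphiC, map_neg_eq_map]

/-! ### Open conditions on the direction -/

lemma smul_mem_sector {θ δ r : ℝ} {x : Fin 2 → ℝ} (hx : x ∈ sector θ δ) :
    r • x ∈ sector θ δ := by
  obtain ⟨t, β, h1, h2, rfl⟩ := hx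
  refine ⟨r * t, β, h1, h2, ?_⟩
  ext k
  fin_cases k <;> simp [mul_assoc]

lemma smul_mem_interior_sector {θ δ r : ℝ} (hr : r ≠ 0) {x : Fin 2 → ℝ}
    (hx : x ∈ interior (sector θ δ)) : r • x ∈ interior (sector θ δ) := by
  rw [mem_interior_iff_mem_nhds] at hx ⊢
  have hc : Tendsto (fun y : Fin 2 → ℝ => r⁻¹ • y) (𝓝 (r • x)) (𝓝 x) := by
    have := (continuous_const_smul (r⁻¹ : ℝ)).tendsto (r • x)
    rwa [inv_smul_smul₀ hr] at this
  filter_upwards [hc hx] with y hy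
  simpa [smul_inv_smul₀ hr] using smul_mem_sector (r := r) hy

lemma neg_mem_interior_sector {θ δ : ℝ} {x : Fin 2 → ℝ}
    (hx : x ∈ interior (sector θ δ)) : -x ∈ interior (sector θ δ) := by
  simpa using smul_mem_interior_sector (r := -1) (by norm_num) hx

/-- Convexity: `x` lies between `x - e` and `x + r • e`, so a norm that increases from the first to
`x` keeps increasing. It supplies `NextGood.lt_sub`, which keeps `W - C` out of the interiors of
earlier cylinders when the direction changes. -/
lemma lt_seminorm_add_smul {N : Seminorm ℝ (Fin 2 → ℝ)} {x e : Fin 2 → ℝ} (h : N (x - e) < N x)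
    {r : ℝ} (hr : 0 < r) : N x < N (x + r • e) := by
  have h1 : (1 + r) • x = (x + r • e) + r • (x - e) := by
    ext k; simp; ring
  have h2 : N ((1 + r) • x) ≤ N (x + r • e) + N (r • (x - e)) := by
    rw [h1]; exact map_add_le_add _ _ _
  rw [map_smul_eq_mul, map_smul_eq_mul, Real.norm_of_nonneg hr.le,
    Real.norm_of_nonneg (by linarith)] at h2
  nlinarith

/-- The requirements which the choice of `W` after `B` and `C` imposes on the direction `v`. -/
structure NextGood (N : Seminorm ℝ (Fin 2 → ℝ)) (θ δ : ℝ) (J : Set ℝ)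
    (B C W : ℤ × (Fin 2 → ℤ)) (v : Fin 2 → ℝ) : Prop where
  halving : 2 * N (phi C v) < N (phi B v)
  length : Real.sqrt W.1 * N (phi C v) ∈ interior J
  direction : phi C v ∈ interior (sector θ δ)
  opposite : OppositeQuadrants (phi B v) (phi C v)
  lt_sub : N (phi B v) < N (phi B v - phi C v)
  points : ∀ X : ℤ × (Fin 2 → ℤ), 0 ≤ X.1 → X.1 ≤ W.1 → N (phi X v) ≤ N (phi C v) →
    X ∈ ({W, C, W - C, 0} : Set (ℤ × (Fin 2 → ℤ)))

lemma finite_lattice_bounded {N : Seminorm ℝ (Fin 2 → ℝ)} {c : ℝ} (hc : 0 < c)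
    (hN : ∀ u, u 0 ^ 2 + c * u 1 ^ 2 ≤ N u ^ 2) (q : ℤ) (L : ℝ) :
    {X : ℤ × (Fin 2 → ℤ) | 0 ≤ X.1 ∧ X.1 ≤ q ∧ N (toReal X.2) ≤ L}.Finite := by
  obtain ⟨M, hM⟩ : ∃ M : ℤ, max |L| (|L| / Real.sqrt c) ≤ M := ⟨_, Int.le_ceil _⟩
  have hc' : 0 < Real.sqrt c := Real.sqrt_pos.mpr hc
  refine ((Set.finite_Icc (0 : ℤ) q).prod
    (Set.Finite.pi' (fun _ : Fin 2 => Set.finite_Icc (-M) M))).subset ?_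
  rintro X ⟨h1, h2, h3⟩
  refine ⟨⟨h1, h2⟩, ?_⟩
  have h4 : N (toReal X.2) ^ 2 ≤ |L| ^ 2 := by
    have := apply_nonneg N (toReal X.2)
    gcongr
    exact h3.trans (le_abs_self _)
  have h5 := (hN (toReal X.2)).trans h4
  have h6 : |(X.2 0 : ℝ)| ≤ |L| := by
    rw [← sq_le_sq]
    have h7 : 0 ≤ c * (X.2 1 : ℝ) ^ 2 := by positivity
    simp only [toReal] at h5
    rw [sq_abs] at h5
    linarith
  have h7 : |(X.2 1 : ℝ)| ≤ |L| / Real.sqrt c := by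
    rw [le_div_iff₀ hc', ← abs_of_pos hc', ← abs_mul, ← sq_le_sq, mul_pow, Real.sq_sqrt hc.le]
    have h8 : 0 ≤ (X.2 0 : ℝ) ^ 2 := by positivity
    simp only [toReal] at h5
    rw [sq_abs] at h5
    linarith
  intro k
  rw [Set.mem_Icc, ← abs_le]
  fin_cases k
  · have := h6.trans ((le_max_left _ _).trans hM)
    exact_mod_cast this
  · have := h7.trans ((le_max_right _ _).trans hM)
    exact_mod_cast this

/-- For directions near `v` only a fixed finite set of integer points can enter the cylinder, and
each point outside `F` is excluded by a strict, hence stable, inequality. -/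
lemma eventually_points {N : Seminorm ℝ (Fin 2 → ℝ)} (hNc : Continuous N) {c : ℝ} (hc : 0 < c)
    (hN : ∀ u, u 0 ^ 2 + c * u 1 ^ 2 ≤ N u ^ 2) {C W : ℤ × (Fin 2 → ℤ)}
    {F : Set (ℤ × (Fin 2 → ℤ))} {v : Fin 2 → ℝ}
    (h : ∀ X : ℤ × (Fin 2 → ℤ), 0 ≤ X.1 → X.1 ≤ W.1 → N (phi X v) ≤ N (phi C v) → X ∈ F) :
    ∀ᶠ v' in 𝓝 v, ∀ X : ℤ × (Fin 2 → ℤ), 0 ≤ X.1 → X.1 ≤ W.1 →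
      N (phi X v') ≤ N (phi C v') → X ∈ F := by
  have hcont : Continuous fun v' => |(W.1 : ℝ)| * N v' + N (phi C v') :=
    (continuous_const.mul hNc).add (hNc.comp (continuous_phi C))
  have h1 := (hcont.tendsto v).eventually_lt_const (lt_add_one _)
  set L := |(W.1 : ℝ)| * N v + N (phi C v) + 1
  have h2 : ∀ X ∈ {X : ℤ × (Fin 2 → ℤ) | 0 ≤ X.1 ∧ X.1 ≤ W.1 ∧ N (toReal X.2) ≤ L},
      ∀ᶠ v' in 𝓝 v, N (phi X v') ≤ N (phi C v') → X ∈ F := by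
    rintro X ⟨hX0, hX1, -⟩
    by_cases hX : X ∈ F
    · exact Eventually.of_forall fun _ _ => hX
    · have h3 : N (phi C v) < N (phi X v) := by
        by_contra! h4
        exact hX (h X hX0 hX1 h4)
      have h4 := ((hNc.comp (continuous_phi C)).tendsto v).eventually_lt
        ((hNc.comp (continuous_phi X)).tendsto v) h3
      filter_upwards [h4] with v' hv' hle
      exact absurd hv' (not_lt.mpr hle)
  filter_upwards [h1, ((finite_lattice_bounded hc hN W.1 L).eventually_all).mpr h2]
    with v' hv1 hv2 X hX0 hX1 hle
  refine hv2 X ⟨hX0, hX1, ?_⟩ hle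
  have h3 : toReal X.2 = (X.1 : ℝ) • v' - phi X v' := by
    simp [phi]
  have h4 : N (toReal X.2) ≤ N ((X.1 : ℝ) • v') + N (phi X v') := by
    rw [h3]; exact map_sub_le_add _ _ _
  rw [map_smul_eq_mul, Real.norm_eq_abs] at h4
  have h5 : |(X.1 : ℝ)| * N v' ≤ |(W.1 : ℝ)| * N v' := by
    refine mul_le_mul_of_nonneg_right ?_ (apply_nonneg _ _)
    exact_mod_cast abs_le_abs_of_nonneg hX0 hX1
  linarith

/-- In the basis `B, C, W` the strict minimum kills the coefficient of `B` and bounds that of `C` by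
one; the height condition `0 ≤ X.1 ≤ W.1` then fixes that of `W`, except that `0` and `W` share the
zero coefficient of `C`. -/
lemma points_of_strict_minimum {N : Seminorm ℝ (Fin 2 → ℝ)} {B C W : ℤ × (Fin 2 → ℤ)}
    (hdet : det3 B C W ^ 2 = 1) (hC : 0 < C.1) (hCW : C.1 < W.1)
    (hpos : 0 < N (phi C (ratio W)))
    (hmin : ∀ k l : ℤ, k ≠ 0 →
        N (phi C (ratio W)) < N ((k : ℝ) • phi B (ratio W) + (l : ℝ) • phi C (ratio W)))
    (X : ℤ × (Fin 2 → ℤ)) (hX0 : 0 ≤ X.1) (hX1 : X.1 ≤ W.1)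
    (hX : N (phi X (ratio W)) ≤ N (phi C (ratio W))) :
    X ∈ ({W, C, W - C, 0} : Set (ℤ × (Fin 2 → ℤ))) := by
  obtain ⟨k, l, t, rfl⟩ := exists_coordinates hdet X
  rw [phi_add, phi_add, phi_zsmul, phi_zsmul, phi_zsmul, phi_ratio_self (hC.trans hCW),
    smul_zero, add_zero] at hX
  obtain rfl : k = 0 := by
    by_contra hk
    exact absurd (hmin k l hk) (not_lt.mpr hX)
  simp only [Int.cast_zero, zero_smul, zero_add, map_smul_eq_mul, Real.norm_eq_abs] at hX
  have hl : |l| ≤ 1 := by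
    have : |(l : ℝ)| ≤ 1 := le_of_mul_le_mul_right (by linarith) hpos
    exact_mod_cast this
  simp only [zero_smul, zero_add, Prod.fst_add, Prod.smul_fst, smul_eq_mul] at hX0 hX1
  rw [abs_le] at hl
  simp only [Set.mem_insert_iff, Set.mem_singleton_iff, zero_smul, zero_add]
  obtain rfl | rfl | rfl : l = -1 ∨ l = 0 ∨ l = 1 := by omega
  · obtain rfl : t = 1 := by
      have h1 : 0 < t := by by_contra! h; nlinarith
      have h2 : t < 2 := by by_contra! h; nlinarith
      omega
    right; right; left
    simp; abel
  · have h1 : 0 ≤ t := by by_contra! h; nlinarith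
    have h2 : t < 2 := by by_contra! h; nlinarith
    obtain rfl | rfl : t = 0 ∨ t = 1 := by omega
    · right; right; right; simp
    · left; simp
  · obtain rfl : t = 0 := by
      have h1 : -1 < t := by by_contra! h; nlinarith
      have h2 : t < 1 := by by_contra! h; nlinarith
      omega
    right; left; simp

lemma NextGood.eventually {N : Seminorm ℝ (Fin 2 → ℝ)} (hNc : Continuous N) {c : ℝ} (hc : 0 < c)
    (hN : ∀ u, u 0 ^ 2 + c * u 1 ^ 2 ≤ N u ^ 2) {θ δ : ℝ} {J : Set ℝ}
    {B C W : ℤ × (Fin 2 → ℤ)} {v : Fin 2 → ℝ} (h : NextGood N θ δ J B C W v) :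
    ∀ᶠ v' in 𝓝 v, NextGood N θ δ J B C W v' := by
  have hB := continuous_phi B
  have hC := continuous_phi C
  have hk : ∀ k, Continuous fun v' => phi B v' k * phi C v' k := fun k => by fun_prop
  have hopen : IsOpen {v' : Fin 2 → ℝ | phi B v' 0 * phi C v' 0 < 0 ∧
      phi B v' 1 * phi C v' 1 < 0} :=
    (isOpen_lt (hk 0) continuous_const).and (isOpen_lt (hk 1) continuous_const)
  filter_upwards [
    (isOpen_lt (continuous_const.mul (hNc.comp hC)) (hNc.comp hB)).mem_nhds h.halving,
    (isOpen_interior.preimage (continuous_const.mul (hNc.comp hC))).mem_nhds h.length,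
    (isOpen_interior.preimage hC).mem_nhds h.direction,
    hopen.mem_nhds h.opposite,
    (isOpen_lt (hNc.comp hB) (hNc.comp (hB.sub hC))).mem_nhds h.lt_sub,
    eventually_points hNc hc hN h.points] with v' h1 h2 h3 h4 h5 h6
  exact ⟨h1, h2, h3, h4, h5, h6⟩

/-! ### Stages of the inductive construction -/

/-- A stage of the construction: three consecutive points and a set of admissible directions. -/
structure Stage where
  (A B C : ℤ × (Fin 2 → ℤ))
  U : Set (Fin 2 → ℝ)

/-- The invariants of the construction. -/
structure Stage.Valid (θ δ : ℝ) (m : ℕ) (z : ℤ → ℤ) (n : ℕ) (σ : Stage) : Prop where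
  det : det3 σ.A σ.B σ.C ^ 2 = 1
  B_nonneg : 0 ≤ σ.B.1
  C_pos : 0 < σ.C.1
  isOpen : IsOpen σ.U
  ratio_mem : ratio σ.C ∈ σ.U
  direction : phi σ.B (ratio σ.C) ∈ interior (sector θ δ)
  ne_zero : ∀ k, phi σ.B (ratio σ.C) k ≠ 0
  residue_A : σ.A.1 ≡ z (n - 2) [ZMOD m]
  residue_B : σ.B.1 ≡ z (n - 1) [ZMOD m]
  residue_C : σ.C.1 ≡ z n [ZMOD m]

/-- The relation between two consecutive stages of the construction. -/
structure Stage.Next (N : Seminorm ℝ (Fin 2 → ℝ)) (θ δ : ℝ) (J : Set ℝ) (n : ℕ)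
    (σ σ' : Stage) : Prop where
  A_eq : σ'.A = σ.B
  B_eq : σ'.B = σ.C
  subset : σ'.U ⊆ σ.U
  growth : (n + 1) * σ.C.1 < σ'.C.1
  convergence : N (ratio σ'.C - ratio σ.C) < (1 / 2 : ℝ) ^ (n + 1)
  good : ∀ v ∈ σ'.U, NextGood N θ δ J σ.B σ.C σ'.C v

lemma exists_residue_step {m : ℕ} {z : ℤ → ℤ} (hz : AdmissibleResidues m z) (n : ℕ) :
    ∃ ε i s : ℤ, ε ^ 2 = 1 ∧ z (n + 1) ≡ s * z n + i * z (n - 1) + ε * z (n - 2) [ZMOD m] := by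
  obtain ⟨-, -, s, i, h⟩ := hz.2.2.2 (n + 1) (by omega)
  rw [show (n : ℤ) + 1 - 1 = n by ring, show (n : ℤ) + 1 - 2 = n - 1 by ring,
    show (n : ℤ) + 1 - 3 = n - 2 by ring] at h
  rcases h with h | h
  · exact ⟨1, i, s, by norm_num, by simpa using h⟩
  · exact ⟨-1, i, s, by norm_num, by simpa [sub_eq_add_neg] using h⟩

lemma Stage.Valid.exists_next {N : Seminorm ℝ (Fin 2 → ℝ)} (hNc : Continuous N) {c : ℝ}
    (hc : 0 < c) (hN : ∀ u, u 0 ^ 2 + c * u 1 ^ 2 ≤ N u ^ 2) {θ δ : ℝ} {m : ℕ} (hm : 1 ≤ m)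
    {z : ℤ → ℤ} (hz : AdmissibleResidues m z) {n : ℕ} {σ : Stage} (hσ : σ.Valid θ δ m z n)
    {α β : ℝ} (hα : 0 ≤ α) (hαβ : α < β) (hβ : 3 * β ^ 4 ≤ 4 * c) (K : ℤ) :
    ∃ σ' : Stage, σ'.Valid θ δ m z (n + 1) ∧ σ.Next N θ δ (Set.Ioo α β) n σ' ∧ K < σ'.C.1 := by
  obtain ⟨A, B, C, U⟩ := σ
  obtain ⟨hdet, hB0, hC0, hU, hUm, hdir, hne, hrA, hrB, hrC⟩ := hσ
  dsimp only at *
  obtain ⟨ε, i₀, s₀, hε, hres⟩ := exists_residue_step hz n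
  set a := phi B (ratio C) with ha
  have hNa : 0 < N a := by
    have h1 := hN a
    have h2 : 0 < a 0 ^ 2 + c * a 1 ^ 2 := by
      have := hne 0
      positivity
    exact (apply_nonneg N a).lt_of_ne' fun h => by rw [h] at h1; linarith
  have hcB := continuous_phi B
  have hcC := continuous_phi C
  have hk : ∀ k, Continuous fun v => phi B v k * a k := fun k => by fun_prop
  have hk' : ∀ k, Continuous fun e : Fin 2 → ℝ => e k * a k := fun k => by fun_prop
  have hC00 : phi C (ratio C) = 0 := phi_ratio_self hC0
  -- Near `ratio C` the displacement of `B` is close to `a` and that of `C` close to `0`, which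
  -- gives halving. The two `N a / 4` bounds, here and in `hV`, put `phi B v - e` below `N a / 2 < N
  -- (phi B v)`, as `lt_seminorm_add_smul` requires.
  have hO : {v : Fin 2 → ℝ | v ∈ U ∧ N (v - ratio C) < (1 / 2 : ℝ) ^ (n + 1) ∧
      0 < phi B v 0 * a 0 ∧ 0 < phi B v 1 * a 1 ∧ N a / 2 < N (phi B v) ∧
      N (phi B v - a) < N a / 4 ∧ 2 * N (phi C v) < N (phi B v)} ∈ 𝓝 (ratio C) := by
    refine IsOpen.mem_nhds ?_ ⟨hUm, by simp, mul_self_pos.mpr (hne 0), mul_self_pos.mpr (hne 1),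
      half_lt_self hNa, by simpa [← ha] using hNa, by simpa [hC00, ← ha] using hNa⟩
    exact hU.and <|
      (isOpen_lt (hNc.comp (continuous_id.sub continuous_const)) continuous_const).and <|
      (isOpen_lt continuous_const (hk 0)).and <|
      (isOpen_lt continuous_const (hk 1)).and <|
      (isOpen_lt continuous_const (hNc.comp hcB)).and <|
      (isOpen_lt (hNc.comp (hcB.sub continuous_const)) continuous_const).and
      (isOpen_lt (continuous_const.mul (hNc.comp hcC)) (hNc.comp hcB))
  have hV : {e : Fin 2 → ℝ | e ∈ interior (sector θ δ) ∧ 0 < e 0 * a 0 ∧ 0 < e 1 * a 1 ∧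
      N (e - a) < N a / 4} ∈ 𝓝 a := by
    refine IsOpen.mem_nhds ?_ ⟨hdir, mul_self_pos.mpr (hne 0), mul_self_pos.mpr (hne 1),
      by simpa using hNa⟩
    exact isOpen_interior.and <|
      (isOpen_lt continuous_const (hk' 0)).and <|
      (isOpen_lt continuous_const (hk' 1)).and <|
      (isOpen_lt (hNc.comp (continuous_id.sub continuous_const)) continuous_const)
  obtain ⟨i, s, W, hW, hi, hs, hK, hW0, ⟨hWU, hconv, hB1, hB2, hB3, hB4, hB5⟩,
    ⟨r, hr, e, ⟨he1, he2, he3, he4⟩, hphiC⟩, hlen, hmin⟩ :=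
    exists_next_point hc hN hdet hC0 (hne 0) hε i₀ s₀ hm hα hαβ hβ hO hV
      (max K ((n + 1) * C.1) : ℤ)
  rw [Int.cast_lt, max_lt_iff] at hK
  have hdet' : det3 B C W ^ 2 = 1 := by rw [hW, det3_step, mul_pow, hε, hdet, one_mul]
  have hCW : C.1 < W.1 := by nlinarith [hK.2, mul_nonneg (Int.natCast_nonneg n) hC0.le]
  have hcomp : ∀ k, 0 < phi B (ratio W) k * a k → 0 < e k * a k →
      phi B (ratio W) k * phi C (ratio W) k < 0 ∧ phi C (ratio W) k ≠ 0 := by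
    intro k h1 h2
    have h3 : phi C (ratio W) k = -(r * e k) := by rw [hphiC]; simp
    have h4 : 0 < (phi B (ratio W) k * e k) * (a k * a k) := by
      have := mul_pos h1 h2
      linarith
    have h5 : 0 < phi B (ratio W) k * e k := pos_of_mul_pos_left h4 (mul_self_nonneg _)
    rw [h3]
    constructor
    · have := mul_pos hr h5
      linarith
    · have : e k ≠ 0 := by rintro h; simp [h] at h2
      simp [hr.ne', this]
  have hdirW : phi C (ratio W) ∈ interior (sector θ δ) := by
    rw [hphiC]
    exact neg_mem_interior_sector (smul_mem_interior_sector hr.ne' he1)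
  have hgood : NextGood N θ δ (Set.Ioo α β) B C W (ratio W) := by
    refine ⟨hB5, by rwa [interior_Ioo], hdirW, ⟨(hcomp 0 hB1 he2).1, (hcomp 1 hB2 he3).1⟩, ?_, ?_⟩
    · rw [hphiC, sub_neg_eq_add]
      refine lt_seminorm_add_smul ?_ hr
      have : N (phi B (ratio W) - e) ≤ N (phi B (ratio W) - a) + N (e - a) := by
        rw [← sub_sub_sub_cancel_right _ _ a]
        exact map_sub_le_add _ _ _
      linarith
    · refine points_of_strict_minimum hdet' hC0 hCW ?_ hmin
      refine pos_of_mul_pos_right (hα.trans_lt hlen.1) (Real.sqrt_nonneg _)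
  have hev := hgood.eventually hNc hc hN
  -- Shrinking `U` forces every later ratio to satisfy the conditions won at this stage.
  refine ⟨⟨B, C, W, U ∩ interior {v | NextGood N θ δ (Set.Ioo α β) B C W v}⟩,
    ⟨hdet', hC0.le, hW0, hU.inter isOpen_interior, ⟨hWU, mem_interior_iff_mem_nhds.mpr hev⟩,
      hdirW, ?_, ?_, ?_, ?_⟩,
    ⟨rfl, rfl, Set.inter_subset_left, hK.2, hconv, fun v hv => interior_subset hv.2⟩, hK.1⟩
  · intro k
    fin_cases k
    · exact (hcomp 0 hB1 he2).2
    · exact (hcomp 1 hB2 he3).2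
  · simpa [show (n : ℤ) + 1 - 2 = n - 1 by ring] using hrB
  · simpa using hrC
  · have hW1 : W.1 = s * C.1 + i * B.1 + ε * A.1 := by rw [hW]; simp; ring
    push_cast
    rw [hW1]
    exact ((((hs.mul hrC).add (hi.mul hrB)).add (hrA.mul_left ε))).trans hres.symm

/-! ### From stages to the required properties -/

lemma phi_toZ3 (w : ℕ × (Fin 2 → ℤ)) (v : Fin 2 → ℝ) :
    phi (toZ3 w) v = (w.1 : ℝ) • v - toReal w.2 := by
  simp [phi, toZ3]

lemma mem_integerPoints_cylinder {N : Seminorm ℝ (Fin 2 → ℝ)} {u : Fin 2 → ℝ} {E R : ℝ}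
    {X : ℤ × (Fin 2 → ℤ)} : X ∈ integerPoints (cylinder N u E R) ↔
      0 ≤ (X.1 : ℝ) ∧ (X.1 : ℝ) ≤ E ∧ N (phi X u) ≤ R := Iff.rfl

/-- An interior point can be moved slightly down, up and radially outwards within the cylinder; `0 <
R` makes the radial move increase the norm on the lateral boundary. -/
lemma lt_of_mem_interior_cylinder {N : Seminorm ℝ (Fin 2 → ℝ)} {u : Fin 2 → ℝ} {E R : ℝ}
    (hR : 0 < R) {x : ℝ × (Fin 2 → ℝ)} (hx : x ∈ interior (cylinder N u E R)) :
    0 < x.1 ∧ x.1 < E ∧ N (x.1 • u - x.2) < R := by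
  have hx' := interior_subset hx
  rw [mem_interior_iff_mem_nhds] at hx
  have hline : ∀ d : ℝ × (Fin 2 → ℝ), ∀ᶠ t : ℝ in 𝓝 0, x + t • d ∈ cylinder N u E R := by
    intro d
    have : Tendsto (fun t : ℝ => x + t • d) (𝓝 0) (𝓝 (x + (0 : ℝ) • d)) :=
      (by fun_prop : Continuous fun t : ℝ => x + t • d).tendsto 0
    rw [zero_smul, add_zero] at this
    exact this hx
  have hpos : ∀ d : ℝ × (Fin 2 → ℝ), ∃ t : ℝ, 0 < t ∧ x + t • d ∈ cylinder N u E R := by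
    intro d
    obtain ⟨t, h1, h2⟩ := (((hline d).filter_mono nhdsWithin_le_nhds).and
      (self_mem_nhdsWithin : Set.Ioi (0 : ℝ) ∈ 𝓝[>] 0)).exists
    exact ⟨t, h2, h1⟩
  refine ⟨?_, ?_, lt_of_le_of_ne hx'.2.2 ?_⟩
  · obtain ⟨t, ht, h⟩ := hpos (-1, 0)
    have := h.1
    simp at this
    linarith
  · obtain ⟨t, ht, h⟩ := hpos (1, 0)
    have := h.2.1
    simp at this
    linarith
  · intro hN
    obtain ⟨t, ht, h⟩ := hpos (0, -(x.1 • u - x.2))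
    have h1 := h.2.2
    have h2 : (x + t • ((0 : ℝ), -(x.1 • u - x.2))).1 • u
        - (x + t • ((0 : ℝ), -(x.1 • u - x.2))).2 = (1 + t) • (x.1 • u - x.2) := by
      ext k; simp; ring
    rw [h2, map_smul_eq_mul, hN, Real.norm_of_nonneg (by linarith)] at h1
    nlinarith

/-- The sequences which the construction produces have all the required properties. -/
lemma properties_of_stages {N : Seminorm ℝ (Fin 2 → ℝ)} (hN : ∀ u, N u = 0 → u = 0) {θ δ : ℝ}
    {I : ℕ → Set ℝ} {m : ℕ} {z : ℤ → ℤ} {p : Fin 2 → ℤ} {w : ℕ → ℕ × (Fin 2 → ℤ)}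
    {σ : ℕ → Stage} (hvalid : ∀ n, (σ n).Valid θ δ m z n)
    (hnext : ∀ n, (σ n).Next N θ δ (I n) n (σ (n + 1))) (hB0 : (σ 0).B = (0, p))
    (hC0 : (σ 0).C.1 = 1) (hw : ∀ n, toZ3 (w n) = (σ n).C) :
    InductiveProperties N θ δ I m z p w ∧ ConsecutiveBases w := by
  have hB : ∀ n, toZ3 (prev p w n) = (σ n).B := by
    rintro (_ | n)
    · rw [hB0]; rfl
    · rw [(hnext n).B_eq]; exact hw n
  have hq : ∀ n, (((w n).1 : ℕ) : ℤ) = (σ n).C.1 := fun n => by rw [← hw]; rfl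
  have hqR : ∀ n, (((w n).1 : ℕ) : ℝ) = (σ n).C.1 := fun n => by rw [← hq]; simp
  have happ : ∀ n, approx w n = ratio (σ n).C := by
    intro n; rw [approx, ratio, ← hqR, ← hw]; rfl
  have hpsi : ∀ n j, psi p w n j = phi (σ j).B (ratio (σ n).C) := by
    intro n j; rw [psi, ← hB, phi_toZ3, happ]
  have hpsi' : ∀ n j, psi p w n (j + 1) = phi (σ j).C (ratio (σ n).C) := by
    intro n j; rw [hpsi, (hnext j).B_eq]
  have hanti : Antitone fun n => (σ n).U := antitone_nat_of_succ_le fun n => (hnext n).subset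
  have hgood : ∀ n j, j + 1 ≤ n →
      NextGood N θ δ (I j) (σ j).B (σ j).C (σ (j + 1)).C (ratio (σ n).C) := fun n j hj =>
    (hnext j).good _ (hanti hj (hvalid n).ratio_mem)
  have hcyl : ∀ n j X, X ∈ integerPoints (cyl N p w n (j + 1)) ↔ 0 ≤ X.1 ∧
      X.1 ≤ (σ (j + 1)).C.1 ∧ N (phi X (ratio (σ n).C)) ≤ N (phi (σ j).C (ratio (σ n).C)) := by
    intro n j X
    rw [cyl, mem_integerPoints_cylinder, radius, hpsi', happ, hqR]
    norm_cast
  have hsub : ∀ n j, j + 1 ≤ n → integerPoints (cyl N p w n (j + 1)) ⊆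
      {toZ3 (w (j + 1)), toZ3 (w j), toZ3 (w (j + 1)) - toZ3 (w j), 0} := by
    intro n j hj X hX
    rw [hcyl] at hX
    rw [hw, hw]
    exact (hgood n j hj).points X hX.1 hX.2.1 hX.2.2
  have hgrowth : ∀ n, (σ n).C.1 < (σ (n + 1)).C.1 := by
    intro n
    nlinarith [(hnext n).growth, mul_nonneg (Int.natCast_nonneg n) (hvalid n).C_pos.le]
  constructor
  · constructor
    · rintro (_ | n) hn
      · omega
      refine Set.Subset.antisymm (hsub _ n le_rfl) ?_
      have hz : phi (σ (n + 1)).C (ratio (σ (n + 1)).C) = 0 := phi_ratio_self (hvalid _).C_pos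
      have hCp := (hvalid n).C_pos
      have hlt := hgrowth n
      rintro X (rfl | rfl | rfl | rfl)
      · rw [hcyl, hw, hz, map_zero]
        exact ⟨by omega, le_rfl, apply_nonneg _ _⟩
      · rw [hcyl, Nat.add_sub_cancel, hw]
        exact ⟨hCp.le, hlt.le, le_rfl⟩
      · rw [hcyl, Nat.add_sub_cancel, hw, hw, phi_sub, hz, zero_sub, map_neg_eq_map, Prod.fst_sub]
        exact ⟨by omega, by omega, le_rfl⟩
      · rw [hcyl, phi_zero, map_zero]
        exact ⟨le_rfl, by simp; omega, apply_nonneg _ _⟩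
    · rintro n (_ | j) hj hjn
      · omega
      exact hsub n j (by omega)
    · rintro n (_ | j) hn hj hjn
      · omega
      rw [Set.eq_empty_iff_forall_notMem]
      intro X hX
      have hg := hgood n j hjn
      have hR : 0 < radius N p w n (j + 1) := by
        rw [radius, hpsi']
        refine (apply_nonneg N _).lt_of_ne' fun h => ?_
        have := hg.opposite.1
        rw [hN _ h] at this
        simp at this
      have hX1 := hsub n j hjn (interior_subset (s := cyl N p w n (j + 1)) hX)
      obtain ⟨h1, h2, h3⟩ := lt_of_mem_interior_cylinder hR hX
      change N (phi X (approx w n)) < _ at h3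
      rw [radius, hpsi', happ] at h3
      simp only [latticePoint] at h1 h2
      rw [hqR] at h2
      rw [hw, hw] at hX1
      -- The first and last points lie on the top and bottom faces, the second on the lateral
      -- boundary. The difference is on the lateral boundary when `n` is the index of the cylinder,
      -- and outside the cylinder for larger `n`.
      rcases hX1 with rfl | rfl | rfl | rfl
      · exact lt_irrefl _ h2
      · exact lt_irrefl _ h3
      · rw [phi_sub] at h3
        rcases hjn.eq_or_lt with rfl | hlt
        · rw [phi_ratio_self (hvalid _).C_pos, zero_sub, map_neg_eq_map] at h3
          exact lt_irrefl _ h3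
        · have h4 := (hgood n (j + 1) hlt).lt_sub
          rw [(hnext j).B_eq] at h4
          rw [map_sub_rev] at h3
          exact lt_asymm h3 h4
      · simp at h1
    · have := hq 0
      rw [hC0] at this
      exact_mod_cast this
    · rintro (_ | n) hn
      · omega
      have := (hnext n).growth
      rw [← hq, ← hq] at this
      exact_mod_cast this
    · rintro n (_ | j) hn hj hjn
      · omega
      rw [radius, radius, hpsi', Nat.add_sub_cancel, hpsi]
      exact (hgood n j hjn).halving
    · rintro n (_ | j) hn hj hjn
      · omega
      rw [Nat.add_sub_cancel, ← phi_toZ3, hw, happ, hqR]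
      exact (hgood n j hjn).length
    · rintro (_ | n) hn
      · omega
      rw [happ, Nat.add_sub_cancel, happ]
      exact (hnext n).convergence
    · rintro n (_ | j) hn hj hjn
      · omega
      rw [hpsi']
      exact (hgood n j hjn).direction
    · intro n j hj hjn
      rw [hpsi', hpsi]
      exact (hgood n j hjn).opposite
    · intro n hn
      rw [hq]
      exact (hvalid n).residue_C
  · intro n hn
    obtain ⟨n, rfl⟩ : ∃ k, n = k + 2 := ⟨n - 2, by omega⟩
    have h := (hvalid (n + 2)).det
    rw [(hnext (n + 1)).A_eq, (hnext (n + 1)).B_eq, (hnext n).B_eq] at h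
    rw [show n + 2 - 2 = n by omega, show n + 2 - 1 = n + 1 by omega, hw, hw, hw]
    exact exists_basis h

/-! ### Counting branches -/

/-- A set of sequences that contains all branches of a binary tree with distinct labels has at
least the cardinality of the continuum. -/
lemma continuum_le_of_branching {S : ℕ → Type} {α : Type} (s₀ : S 0)
    (R : ∀ n, S n → S (n + 1) → Prop) (out : ∀ n, S n → α)
    (h : ∀ n s, ∃ f : Bool → S (n + 1), (∀ b, R n s (f b)) ∧
      Function.Injective fun b => out (n + 1) (f b))
    (G : Set (ℕ → α)) (hG : ∀ σ : ∀ n, S n, σ 0 = s₀ → (∀ n, R n (σ n) (σ (n + 1))) →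
      (fun n => out n (σ n)) ∈ G) : Cardinal.continuum ≤ Cardinal.mk G := by
  choose F hF hinj using h
  let path : (ℕ → Bool) → ∀ n, S n := fun b n => Nat.rec s₀ (fun n s => F n s (b n)) n
  have hpath : ∀ b n, path b (n + 1) = F n (path b n) (b n) := fun _ _ => rfl
  let g : (ℕ → Bool) → G := fun b =>
    ⟨fun n => out n (path b n), hG _ rfl fun n => hF n (path b n) (b n)⟩
  have hg : Function.Injective g := by
    intro b b' hbb
    have hout : ∀ n, out n (path b n) = out n (path b' n) := fun n =>
      congrFun (congrArg Subtype.val hbb) n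
    have hstep : ∀ n, path b n = path b' n → b n = b' n := by
      intro n hn
      have := hout (n + 1)
      rw [hpath, hpath, hn] at this
      exact hinj n _ this
    have hall : ∀ n, path b n = path b' n := by
      intro n
      induction n with
      | zero => rfl
      | succ n ih => rw [hpath, hpath, hstep n ih, ih]
    exact funext fun n => hstep n (hall n)
  have := Cardinal.mk_le_of_injective hg
  rwa [← Cardinal.power_def, Cardinal.mk_bool, Cardinal.mk_nat, Cardinal.two_power_aleph0] at this

lemma mk_sequences_le (G : Set (ℕ → ℕ × (Fin 2 → ℤ))) :
    Cardinal.mk G ≤ Cardinal.continuum := by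
  refine (Cardinal.mk_set_le G).trans_eq ?_
  rw [← Cardinal.power_def, Cardinal.mk_nat, Cardinal.mk_eq_aleph0,
    Cardinal.aleph0_power_aleph0]

/-! ### Starting vector, initial stage and assembly -/

/-- In coordinates rotated by `θ` the angle is the arctangent of the slope `y' / y`, which avoids a
case analysis of polar angles. -/
lemma isOpen_subset_sector {θ d δ : ℝ} (hd : d < Real.pi / 2) (hd0 : 0 < d) (hdδ : d ≤ δ) :
    {x : Fin 2 → ℝ | 0 < x 0 * Real.cos θ + x 1 * Real.sin θ ∧
      |x 1 * Real.cos θ - x 0 * Real.sin θ| <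
        Real.tan d * (x 0 * Real.cos θ + x 1 * Real.sin θ)} ⊆ interior (sector θ δ) := by
  refine interior_maximal ?_
    ((isOpen_lt (by fun_prop) (by fun_prop)).and (isOpen_lt (by fun_prop) (by fun_prop)))
  rintro x ⟨h0, h1⟩
  set y := x 0 * Real.cos θ + x 1 * Real.sin θ with hy
  set y' := x 1 * Real.cos θ - x 0 * Real.sin θ with hy'
  have htan : Real.arctan (Real.tan d) = d :=
    Real.arctan_tan (by linarith) hd
  rw [abs_lt] at h1
  have hup : Real.arctan (y' / y) ≤ d := by
    rw [← htan]
    apply Real.arctan_mono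
    rw [div_le_iff₀ h0]; linarith
  have hlow : -d ≤ Real.arctan (y' / y) := by
    rw [← htan, ← Real.arctan_neg]
    apply Real.arctan_mono
    rw [le_div_iff₀ h0]; linarith
  have hs : 0 < Real.sqrt (1 + (y' / y) ^ 2) := Real.sqrt_pos.mpr (by positivity)
  have htrig := Real.sin_sq_add_cos_sq θ
  refine ⟨y * Real.sqrt (1 + (y' / y) ^ 2), θ + Real.arctan (y' / y), by linarith, by linarith, ?_⟩
  ext k
  fin_cases k
  · simp only [Real.cos_add, Real.cos_arctan, Real.sin_arctan]
    simp
    field_simp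
    rw [hy, hy']
    linear_combination (-x 0) * htrig
  · simp only [Real.sin_add, Real.cos_arctan, Real.sin_arctan]
    simp
    field_simp
    rw [hy, hy']
    linear_combination (-x 1) * htrig

/-- Rational vectors with nonzero coordinates are dense, and the sector is invariant under scaling,
so denominators and common factors can be removed. Nonzero coordinates are what gives the
alternating quadrants a start. -/
lemma exists_coprime_mem_sector (θ : ℝ) {δ : ℝ} (hδ : 0 < δ) :
    ∃ p : Fin 2 → ℤ, IsCoprime (p 0) (p 1) ∧ (∀ k, p k ≠ 0) ∧
      toReal p ∈ interior (sector θ δ) := by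
  have hd : min δ 1 < Real.pi / 2 := (min_le_right _ _).trans_lt (by linarith [Real.pi_gt_three])
  have hd0 : 0 < min δ 1 := lt_min hδ one_pos
  have hne : (interior (sector θ δ)).Nonempty := by
    refine ⟨![Real.cos θ, Real.sin θ], isOpen_subset_sector hd hd0 (min_le_left _ _) ⟨?_, ?_⟩⟩
    · simp [← sq]
    · have := Real.tan_pos_of_pos_of_lt_pi_div_two hd0 hd
      simpa [← sq, mul_comm] using this
  have hdense : Dense (Set.pi Set.univ
      fun _ : Fin 2 => Set.range ((↑) : ℚ → ℝ) \ {0}) :=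
    dense_pi _ fun _ _ => Rat.denseRange_cast.sdiff_singleton 0
  obtain ⟨x, hx, hxQ⟩ := hdense.inter_open_nonempty _ isOpen_interior hne
  have hxQ' : ∀ k, ∃ r : ℚ, (r : ℝ) = x k := fun k => (hxQ k trivial).1
  have hx0 : ∀ k, x k ≠ 0 := fun k => (hxQ k trivial).2
  choose r hr using hxQ'
  have hr0 : ∀ k, (r k).num ≠ 0 := by
    intro k h
    have : r k = 0 := Rat.num_eq_zero.mp h
    exact hx0 k (by rw [← hr, this, Rat.cast_zero])
  have hden : ∀ k, ((r k).den : ℝ) ≠ 0 := fun k => by exact_mod_cast (r k).den_nz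
  have hnum : ∀ k, ((r k).num : ℝ) = x k * (r k).den := by
    intro k
    rw [← hr, Rat.cast_def]
    field_simp [hden k]
  set P₀ : ℤ := (r 0).num * (r 1).den
  set P₁ : ℤ := (r 1).num * (r 0).den
  have hP₀ : P₀ ≠ 0 := mul_ne_zero (hr0 0) (by exact_mod_cast (r 1).den_nz)
  have hP₁ : P₁ ≠ 0 := mul_ne_zero (hr0 1) (by exact_mod_cast (r 0).den_nz)
  obtain ⟨a, b, hab, ha, hb⟩ := Int.exists_gcd_one (Int.gcd_pos_of_ne_zero_left P₁ hP₀)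
  set g := Int.gcd P₀ P₁
  have hg : (g : ℝ) ≠ 0 := by
    have : g ≠ 0 := (Int.gcd_pos_of_ne_zero_left P₁ hP₀).ne'
    exact_mod_cast this
  have ha' : (a : ℝ) * g = x 0 * (r 0).den * (r 1).den := by
    rw [← hnum]; exact_mod_cast ha.symm
  have hb' : (b : ℝ) * g = x 1 * (r 1).den * (r 0).den := by
    rw [← hnum]; exact_mod_cast hb.symm
  refine ⟨![a, b], Int.isCoprime_iff_gcd_eq_one.mpr hab, ?_, ?_⟩
  · intro k
    fin_cases k
    · rintro h
      exact hP₀ (by rw [ha, show a = 0 from h, zero_mul])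
    · rintro h
      exact hP₁ (by rw [hb, show b = 0 from h, zero_mul])
  · have h : toReal ![a, b] = ((r 0).den * (r 1).den / g : ℝ) • x := by
      ext k
      fin_cases k
      · simp [toReal]; field_simp; linarith
      · simp [toReal]; field_simp; linarith
    rw [h]
    exact smul_mem_interior_sector (div_ne_zero (mul_ne_zero (hden 0) (hden 1)) hg) hx

lemma continuous_of_ellipsoid_bound {N : Seminorm ℝ (Fin 2 → ℝ)} {c D : ℝ}
    (h : ∀ u, N u ≤ D * ellipsoidNorm 1 c u) : Continuous N := by
  apply Seminorm.continuous_of_continuousAt_zero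
  rw [ContinuousAt, map_zero]
  have hcont : Continuous fun u => D * ellipsoidNorm 1 c u := by
    unfold ellipsoidNorm; fun_prop
  have h0 := hcont.tendsto 0
  rw [show D * ellipsoidNorm 1 c 0 = 0 by simp [ellipsoidNorm]] at h0
  exact tendsto_of_tendsto_of_tendsto_of_le_of_le tendsto_const_nhds h0
    (fun u => apply_nonneg N u) h

/-- Bézout coefficients of `p` complete `(0, p)` and `(1, 0)` to a unimodular triple; the first
coordinates `0, 0, 1` match `z (-2), z (-1), z 0`. -/
lemma exists_initial_stage {θ δ : ℝ} {m : ℕ} {z : ℤ → ℤ} (hz : AdmissibleResidues m z)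
    {p : Fin 2 → ℤ} (hp : IsCoprime (p 0) (p 1)) (hp0 : ∀ k, p k ≠ 0)
    (hdir : toReal p ∈ interior (sector θ δ)) :
    ∃ σ : Stage, σ.Valid θ δ m z 0 ∧ σ.B = (0, p) ∧ σ.C = (1, 0) := by
  obtain ⟨x, y, hxy⟩ := hp
  have hphi : phi ((0, p) : ℤ × (Fin 2 → ℤ)) (ratio (1, 0)) = -toReal p := by
    simp [phi]
  refine ⟨⟨(0, ![-y, x]), (0, p), (1, 0), Set.univ⟩, ⟨?_, le_rfl, one_pos, isOpen_univ,
    trivial, ?_, ?_, ?_, ?_, ?_⟩, rfl, rfl⟩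
  · have : det3 (0, ![-y, x]) (0, p) (1, 0) = -(x * p 0 + y * p 1) := by
      simp [det3]; ring
    rw [this, hxy]; norm_num
  · rw [hphi]; exact neg_mem_interior_sector hdir
  · intro k
    rw [hphi]
    simpa [toReal] using hp0 k
  · simp [hz.1]
  · simp [hz.2.1]
  · simp [hz.2.2.1]

lemma Stage.Valid.exists_two_next {N : Seminorm ℝ (Fin 2 → ℝ)} (hNc : Continuous N) {c : ℝ}
    (hc : 0 < c) (hN : ∀ u, u 0 ^ 2 + c * u 1 ^ 2 ≤ N u ^ 2) {θ δ : ℝ} {m : ℕ} (hm : 1 ≤ m)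
    {z : ℤ → ℤ} (hz : AdmissibleResidues m z) {n : ℕ} {σ : Stage} (hσ : σ.Valid θ δ m z n)
    {α β : ℝ} (hα : 0 ≤ α) (hαβ : α < β) (hβ : 3 * β ^ 4 ≤ 4 * c) :
    ∃ f : Bool → Stage, (∀ b, (f b).Valid θ δ m z (n + 1) ∧
      σ.Next N θ δ (Set.Ioo α β) n (f b)) ∧ (f false).C.1 < (f true).C.1 := by
  obtain ⟨σ₁, h1, h2, -⟩ := hσ.exists_next hNc hc hN hm hz hα hαβ hβ 0
  obtain ⟨σ₂, h3, h4, h5⟩ := hσ.exists_next hNc hc hN hm hz hα hαβ hβ σ₁.C.1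
  refine ⟨fun b => if b then σ₂ else σ₁, ?_, by simpa using h5⟩
  rintro (_ | _)
  · exact ⟨h1, h2⟩
  · exact ⟨h3, h4⟩

end Displacement

end

theorem theorem2 (N : Seminorm ℝ (Fin 2 → ℝ)) (hN : ∀ u, N u = 0 → u = 0) (c D : ℝ)
    (hbest : Displacement.IsBestEllipsoidNorm N 1 c D) :
    0 < (4 * c / (4 * D ^ 2 - 1)) ^ (1 / 4 : ℝ) ∧
    ∀ θ δ : ℝ, 0 ≤ θ → θ < 2 * Real.pi → 0 < δ →
    ∀ I : ℕ → Set ℝ, (∀ n, ∃ a b : ℝ, a < b ∧ I n = Set.Ioo a b) →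
      (∀ n, I n ⊆ Set.Icc 0 ((4 * c / (4 * D ^ 2 - 1)) ^ (1 / 4 : ℝ))) →
    ∀ m : ℕ, 1 ≤ m → ∀ z : ℤ → ℤ, Displacement.AdmissibleResidues m z →
    ∃ p : Fin 2 → ℤ, IsCoprime (p 0) (p 1) ∧
      Displacement.toReal p ∈ interior (Displacement.sector θ δ) ∧
      Cardinal.mk {w : ℕ → ℕ × (Fin 2 → ℤ) |
        Displacement.InductiveProperties N θ δ I m z p w ∧ Displacement.ConsecutiveBases w}
        = Cardinal.continuum := by
  open Displacement in
  obtain ⟨⟨-, hc, hD, hbound⟩, -⟩ := hbest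
  -- This turns `β ≤ M` into `3 β⁴ ≤ 4 c`, the form in which the length bound enters the
  -- construction.
  have hD3 : 3 ≤ 4 * D ^ 2 - 1 := by nlinarith
  have hM0 : 0 < 4 * c / (4 * D ^ 2 - 1) := div_pos (by linarith) (by linarith)
  have hM4 : ((4 * c / (4 * D ^ 2 - 1)) ^ (1 / 4 : ℝ)) ^ 4 = 4 * c / (4 * D ^ 2 - 1) := by
    rw [← Real.rpow_natCast, ← Real.rpow_mul hM0.le]
    norm_num
  refine ⟨Real.rpow_pos_of_pos hM0 _, ?_⟩
  set M := (4 * c / (4 * D ^ 2 - 1)) ^ (1 / 4 : ℝ)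
  intro θ δ _ _ hδ I hI hIM m hm z hz
  have hNsq : ∀ u, u 0 ^ 2 + c * u 1 ^ 2 ≤ N u ^ 2 := by
    intro u
    have h := (hbound u).1
    rw [ellipsoidNorm, one_mul] at h
    exact (Real.sqrt_le_left (apply_nonneg N u)).mp h
  have hNc : Continuous N := continuous_of_ellipsoid_bound fun u => (hbound u).2
  have hI' : ∀ n, ∃ α β : ℝ, 0 ≤ α ∧ α < β ∧ 3 * β ^ 4 ≤ 4 * c ∧ I n = Set.Ioo α β := by
    intro n
    obtain ⟨α, β, hαβ, hIn⟩ := hI n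
    have hsub : Set.Icc α β ⊆ Set.Icc 0 M := by
      rw [← closure_Ioo hαβ.ne, ← hIn]
      exact closure_minimal (hIM n) isClosed_Icc
    have h0 := (hsub (Set.left_mem_Icc.mpr hαβ.le)).1
    have h1 := (hsub (Set.right_mem_Icc.mpr hαβ.le)).2
    refine ⟨α, β, h0, hαβ, ?_, hIn⟩
    have h2 : β ^ 4 ≤ M ^ 4 := by
      have := h0.trans hαβ.le
      gcongr
    rw [hM4, le_div_iff₀ (by linarith)] at h2
    have h3 : 0 ≤ β ^ 4 := by positivity
    nlinarith
  obtain ⟨p, hp, hp0, hpdir⟩ := exists_coprime_mem_sector θ hδ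
  refine ⟨p, hp, hpdir, le_antisymm (mk_sequences_le _) ?_⟩
  obtain ⟨σ₀, hσ₀, hB, hC⟩ := exists_initial_stage hz hp hp0 hpdir
  refine continuum_le_of_branching (S := fun n => {σ : Stage // σ.Valid θ δ m z n})
    (⟨σ₀, hσ₀⟩ : {σ : Stage // σ.Valid θ δ m z (0 : ℕ)})
    (fun n σ σ' => σ.1.Next N θ δ (I n) n σ'.1)
    -- `toNat` loses nothing, since valid stages have `C.1 > 0`.
    (fun _ σ => (σ.1.C.1.toNat, σ.1.C.2)) ?_ _ ?_
  · rintro n ⟨σ, hσ⟩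
    obtain ⟨α, β, hα, hαβ, hβ, hIn⟩ := hI' n
    obtain ⟨f, hf, hlt⟩ := hσ.exists_two_next hNc hc hNsq hm hz hα hαβ hβ
    have hne : (f false).C.1.toNat ≠ (f true).C.1.toNat := by
      have := (hf false).1.C_pos
      omega
    refine ⟨fun b => ⟨f b, (hf b).1⟩, fun b => by rw [hIn]; exact (hf b).2, ?_⟩
    rintro (_ | _) (_ | _) h
    · rfl
    · exact absurd (congrArg Prod.fst h) hne
    · exact absurd (congrArg Prod.fst h) hne.symm
    · rfl
  · intro σ hσ0 hnext
    refine properties_of_stages hN (σ := fun n => (σ n).1) (fun n => (σ n).2) hnext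
      (by rw [hσ0]; exact hB) (by rw [hσ0, hC]) fun n => ?_
    have := (σ n).2.C_pos
    ext k
    · simp only [toZ3]; omega
    · rfl
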